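/- **Setting.** Let $(W,S)$ be a simply laced Coxeter system, i.e. $m(s,s')\in\{2,3\}$ for all distinct $s,s'\in S$, with length function $\ell$ and set of reflections $T=\{wsw^{-1}: w\in W, s\in S\}$. Let $V$ be its root space: the real vector space with basis the simple roots, on which $W$ acts by the geometric representation. For $t\in T$ let $\alpha_t\in V$ be the corresponding positive root. For $A\subseteq T$ and $w\in W$ put $\mathrm{Des}_A(w)=\{t\in A:\ell(tw)<\ell(w)\}$. A *basic flat* $L\subseteq V^*$ is an intersection of hyperplanes of the form $H_{t,\varepsilon}=\{f\in V^*:\langle f,\alpha_t\rangle=\varepsilon\}$ with $t\in T$, $\varepsilon\in\{1,-1\}$. Put $A_L=\{t\in T: L\subseteq H_{t,\varepsilon}\text{ for some }\varepsilon\in\{1,-1\}\}$. The *$L$-partition* of $W$ consists of the sets $W_{A_L}^D=\{w\in W:\mathrm{Des}_{A_L}(w)=D\}$, $D\subseteq A_L$; these are convex in the Hasse diagram of the right weak order. For a convex $\mathcal K\subseteq W$ let $T_{\mathcal K}=\{wsw^{-1}: s\in S, w\in\mathcal K, ws\in\mathcal K\}$ and $T_{\partial\mathcal K}=\{wsw^{-1}: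 s\in S, w\in\mathcal K, ws\notin\mathcal K\}$. A functional $f\in V^*$ is *$\mathcal K$-generic* if 1. $\langle f,\alpha_t\rangle\notin\{0,1,-1\}$ for all $t\in T_{\mathcal K}$; 2. $\langle f,\alpha_t\rangle\in\{1,-1\}$ for all $t\in T_{\partial\mathcal K}$; 3. if $w\in\mathcal K$, $s,s'\in S$, $m(s,s')=3$ and $ws,ws'\notin\mathcal K$, then $\epsilon_{w,s}\langle f,\alpha_{wsw^{-1}}\rangle=\epsilon_{w,s'}\langle f,\alpha_{ws'w^{-1}}\rangle$, where $\epsilon_{w,s}=1$ if $\ell(w)<\ell(ws)$ and $\epsilon_{w,s}=-1$ otherwise. (If $\mathcal K$ contains the identity, all signs occurring here are $1$.) For $f\in V^*$ let $A_f=\{t\in T:\langle f,\alpha_t\rangle\in\{1,-1\}\}$, and for $w\in W$ let $\mathcal K^f_w=\{u\in W:\mathrm{Des}_{A_f}(u)=\mathrm{Des}_{A_f}(w)\}$. If $f$ is $\mathcal K^f_w$-generic, then $\rho^f_w$ denotes the complex representation of $W$ on the space with basis $\{C_u: u\in\mathcal K^f_w\}$ in which, for $s\in S$, $u\in\mathcal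 K^f_w$ and $t=usu^{-1}$, $$\rho^f_w(s)\,C_u=\pm\frac{1}{\langle f,\alpha_t\rangle}\,C_u+b_t\,C_{us},$$ with sign $+$ if $\ell(u)<\ell(us)$ and $-$ otherwise, with $C_{us}$ read as $0$ if $us\notin\mathcal K^f_w$, and where $b_t\in\mathbb C$ is any fixed choice of a number with $b_t^2=1-\langle f,\alpha_t\rangle^{-2}$, for each $t\in T_{\mathcal K^f_w}$. **Theorem.** Let $W$ be simply laced, let $L$ be a basic flat in $V^*$, and let $\mathcal K$ be a nonempty finite convex set in the $L$-partition of $W$. Then for any $v,v'\in\mathcal K$ and any $\mathcal K$-generic $f,f'\in L$ one has $\mathcal K^f_v=\mathcal K^{f'}_{v'}=\mathcal K$, and, for all choices of the numbers $b_t$, the formulas above define representations $\rho^f_v$ and $\rho^{f'}_{v'}$ of $W$, and these are isomorphic. -/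

import Mathlib

open Module

noncomputable section

namespace AbstractYoung

/-- The root space `V` of a Coxeter group: the real vector space with basis the simple roots
`α_i`, one for each generator. -/
abbrev RootSpace (B : Type*) : Type _ := B →₀ ℝ

/-- The simple root `α_i`. -/
def simpleRoot {B : Type*} (i : B) : RootSpace B := Finsupp.single i 1

/-- The linear functional `v ↦ 2 B(α_i, v)`, where `B` is the standard symmetric bilinear form
`B(α_i, α_j) = -cos (π / m(i, j))`. (Mathlib writes `m(i, j) = 0` for `m(i, j) = ∞`; the formula
then gives `B(α_i, α_j) = -1`, as it should.) -/
def simpleCoroot {B : Type*} (M : CoxeterMatrix B) (i : B) : Dual ℝ (RootSpace B) :=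
  Finsupp.linearCombination ℝ fun j => -2 * Real.cos (Real.pi / (M i j : ℝ))

theorem simpleCoroot_simpleRoot {B : Type*} (M : CoxeterMatrix B) (i j : B) :
    simpleCoroot M i (simpleRoot j) = -2 * Real.cos (Real.pi / (M i j : ℝ)) := by
  simp [simpleCoroot, simpleRoot]

theorem simpleCoroot_self {B : Type*} (M : CoxeterMatrix B) (i : B) :
    simpleCoroot M i (simpleRoot i) = 2 := by
  simp [simpleCoroot_simpleRoot]

/-- The simple reflection `v ↦ v - 2 B(α_i, v) α_i` of the root space. -/
def simpleReflection {B : Type*} (M : CoxeterMatrix B) (i : B) :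
    RootSpace B ≃ₗ[ℝ] RootSpace B :=
  Module.reflection (simpleCoroot_self M i)

theorem sin_mul_S_eval (θ : ℝ) (n : ℤ) (hs : Real.sin θ ≠ 0) :
    (Polynomial.Chebyshev.S ℝ n).eval (2 * Real.cos θ) = Real.sin ((n + 1) * θ) / Real.sin θ := by
  rw [eq_div_iff hs]
  exact Polynomial.Chebyshev.S_two_mul_real_cos θ n

theorem simpleReflection_isLiftable {B : Type*} (M : CoxeterMatrix B) :
    M.IsLiftable (simpleReflection M) := by
  intro i j
  obtain h0 | h1 | h2 | h3 : M i j = 0 ∨ M i j = 1 ∨ M i j = 2 ∨ 3 ≤ M i j := by omega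
  · rw [h0, pow_zero]
  · have hij : i = j := by
      by_contra h
      exact M.off_diagonal i j h h1
    subst hij
    rw [h1, pow_one]
    ext1 v
    exact Module.involutive_reflection (simpleCoroot_self M i) v
  · have hji : M j i = 2 := by rw [M.symmetric, h2]
    ext1 v
    rw [h2]
    have := Module.reflection_mul_reflection_pow_apply (simpleCoroot_self M i)
      (simpleCoroot_self M j) 2 v
    refine this.trans ?_
    simp [simpleCoroot_simpleRoot, h2, hji, Polynomial.Chebyshev.S_neg_one]
    module
  · have hji : M j i = M i j := M.symmetric j i
    set m := M i j with hm
    set θ : ℝ := 2 * (Real.pi / (m : ℝ)) with hθ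
    have hm3 : (3 : ℝ) ≤ m := by exact_mod_cast h3
    have hmθ : (m : ℝ) * θ = 2 * Real.pi := by rw [hθ]; field_simp
    have hpos : 0 < θ := by rw [hθ]; have := Real.pi_pos; positivity
    have hlt : θ < Real.pi := by
      have := Real.pi_pos
      nlinarith
    have hs : Real.sin θ ≠ 0 := (Real.sin_pos_of_pos_of_lt_pi hpos hlt).ne'
    have ht : 2 * Real.cos θ = simpleCoroot M i (simpleRoot j) *
        simpleCoroot M j (simpleRoot i) - 2 := by
      rw [simpleCoroot_simpleRoot, simpleCoroot_simpleRoot, hji, ← hm, hθ, Real.cos_two_mul]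
      ring
    have key : ∀ k : ℤ, (m : ℤ) = 2 * k + 1 →
        (Polynomial.Chebyshev.S ℝ k).eval (2 * Real.cos θ) +
          (Polynomial.Chebyshev.S ℝ (k - 1)).eval (2 * Real.cos θ) = 0 := by
      intro k hk
      have hk' : (m : ℝ) = 2 * k + 1 := by exact_mod_cast hk
      rw [sin_mul_S_eval _ _ hs, sin_mul_S_eval _ _ hs, ← add_div]
      have e : ((k : ℝ) + 1) * θ = 2 * Real.pi - k * θ := by
        rw [← hmθ, hk']; ring
      push_cast
      rw [e, Real.sin_two_pi_sub]
      simp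
    have key2 : ∀ k : ℤ, (m : ℤ) = 2 * k →
        (Polynomial.Chebyshev.S ℝ (k - 1)).eval (2 * Real.cos θ) = 0 := by
      intro k hk
      have hk' : (m : ℝ) = 2 * k := by exact_mod_cast hk
      rw [sin_mul_S_eval _ _ hs]
      have e : (k : ℝ) * θ = Real.pi := by
        rw [hk'] at hmθ; linarith
      push_cast
      rw [sub_add_cancel, e]
      simp
    ext1 v
    have := Module.reflection_mul_reflection_pow_apply (simpleCoroot_self M i)
      (simpleCoroot_self M j) m v (2 * Real.cos θ) ht
    refine this.trans ?_
    obtain ⟨k, hk | hk⟩ := Int.even_or_odd' (m : ℤ)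
    · have e1 : ((m : ℤ) - 2) / 2 = k - 1 := by omega
      have e2 : ((m : ℤ) - 1) / 2 = k - 1 := by omega
      rw [e1, e2, key2 k hk]
      simp
    · have e1 : ((m : ℤ) - 2) / 2 = k - 1 := by omega
      have e2 : ((m : ℤ) - 1) / 2 = k := by omega
      have e3 : ((m : ℤ) - 3) / 2 = k - 1 := by omega
      have e4 : (m : ℤ) / 2 = k := by omega
      rw [e1, e2, e3, e4, key k hk]
      simp

/-- The geometric representation of a Coxeter group on its root space. -/
def geomRep {B W : Type*} [Group W] {M : CoxeterMatrix B} (cs : CoxeterSystem M W) :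
    W →* (RootSpace B ≃ₗ[ℝ] RootSpace B) :=
  cs.lift ⟨simpleReflection M, simpleReflection_isLiftable M⟩

/-- `β` is a positive root belonging to the reflection `t`: it is a root `w α_i` with
`t = w s_i w⁻¹`, and its coordinates in the basis of simple roots are nonnegative. -/
def IsPosRoot {B W : Type*} [Group W] {M : CoxeterMatrix B} (cs : CoxeterSystem M W)
    (t : W) (β : RootSpace B) : Prop :=
  (∃ (w : W) (i : B), t = w * cs.simple i * w⁻¹ ∧ β = geomRep cs w (simpleRoot i)) ∧
    ∀ j, 0 ≤ β j

/-- The positive root `α_t` of a reflection `t` (it exists and is unique for every reflection;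
irrelevant value for other elements). -/
def posRoot {B W : Type*} [Group W] {M : CoxeterMatrix B} (cs : CoxeterSystem M W)
    (t : W) : RootSpace B :=
  Classical.epsilon (IsPosRoot cs t)

/-- A Coxeter matrix is simply laced if `m(i, j) ∈ {2, 3}` for all `i ≠ j`. -/
def IsSimplyLaced {B : Type*} (M : CoxeterMatrix B) : Prop :=
  ∀ i j, i ≠ j → M i j = 2 ∨ M i j = 3

/-- The `A`-descent set `Des_A(w) = {t ∈ A | ℓ(tw) < ℓ(w)}`. -/
def des {B W : Type*} [Group W] {M : CoxeterMatrix B} (cs : CoxeterSystem M W)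
    (A : Set W) (w : W) : Set W :=
  {t | t ∈ A ∧ cs.length (t * w) < cs.length w}

/-- Convexity in the Hasse diagram of the right weak order, i.e. in the graph on `W` with
edges `w — w s_i`: with any two elements, `K` contains all vertices on the geodesics
between them. (The graph distance of `x` and `y` is `ℓ(x⁻¹ y)`.) -/
def IsConvex {B W : Type*} [Group W] {M : CoxeterMatrix B} (cs : CoxeterSystem M W)
    (K : Set W) : Prop :=
  ∀ x ∈ K, ∀ z ∈ K, ∀ y,
    cs.length (x⁻¹ * y) + cs.length (y⁻¹ * z) = cs.length (x⁻¹ * z) → y ∈ K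

/-- `T_K = {w s w⁻¹ | w ∈ K, ws ∈ K}`. -/
def innerRefl {B W : Type*} [Group W] {M : CoxeterMatrix B} (cs : CoxeterSystem M W)
    (K : Set W) : Set W :=
  {t | ∃ w ∈ K, ∃ i, w * cs.simple i ∈ K ∧ t = w * cs.simple i * w⁻¹}

/-- `T_∂K = {w s w⁻¹ | w ∈ K, ws ∉ K}`. -/
def boundaryRefl {B W : Type*} [Group W] {M : CoxeterMatrix B} (cs : CoxeterSystem M W)
    (K : Set W) : Set W :=
  {t | ∃ w ∈ K, ∃ i, w * cs.simple i ∉ K ∧ t = w * cs.simple i * w⁻¹}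

/-- `1` if `ℓ(w) < ℓ(w s_i)`, and `-1` otherwise. -/
def stepSign {B W : Type*} [Group W] {M : CoxeterMatrix B} (cs : CoxeterSystem M W)
    (w : W) (i : B) : ℝ :=
  if cs.length w < cs.length (w * cs.simple i) then 1 else -1

/-- `K`-genericity of a linear functional on the root space, for convex `K`. If `1 ∈ K` the
signs in `corner` are all `1`, see `isGeneric_iff_of_one_mem`; in general they express that
genericity is invariant under simultaneous left translation of `K` and `f`. -/
structure IsGeneric {B W : Type*} [Group W] {M : CoxeterMatrix B} (cs : CoxeterSystem M W)
    (K : Set W) (f : Dual ℝ (RootSpace B)) : Prop where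
  inner : ∀ t ∈ innerRefl cs K,
    f (posRoot cs t) ≠ 0 ∧ f (posRoot cs t) ≠ 1 ∧ f (posRoot cs t) ≠ -1
  boundary : ∀ t ∈ boundaryRefl cs K, f (posRoot cs t) = 1 ∨ f (posRoot cs t) = -1
  corner : ∀ w ∈ K, ∀ i j, M i j = 3 → w * cs.simple i ∉ K → w * cs.simple j ∉ K →
    stepSign cs w i * f (posRoot cs (w * cs.simple i * w⁻¹)) =
      stepSign cs w j * f (posRoot cs (w * cs.simple j * w⁻¹))

/-- For convex `K` containing the identity, a step out of `K` increases the length. -/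
theorem stepSign_eq_one {B W : Type*} [Group W] {M : CoxeterMatrix B} (cs : CoxeterSystem M W)
    {K : Set W} (hK : IsConvex cs K) (h1 : 1 ∈ K) {w : W} (hw : w ∈ K) {i : B}
    (hi : w * cs.simple i ∉ K) : stepSign cs w i = 1 := by
  unfold stepSign
  rw [if_pos]
  by_contra hlt
  apply hi
  apply hK 1 h1 w hw
  rcases cs.length_mul_simple w i with h | h
  · omega
  · simp only [inv_one, one_mul, mul_inv_rev, cs.inv_simple, inv_mul_cancel_right,
      cs.length_simple]
    exact h

/-- For convex `K` containing the identity, genericity is given by the unsigned conditions. -/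
theorem isGeneric_iff_of_one_mem {B W : Type*} [Group W] {M : CoxeterMatrix B}
    (cs : CoxeterSystem M W) {K : Set W} (hK : IsConvex cs K) (h1 : 1 ∈ K)
    (f : Dual ℝ (RootSpace B)) :
    IsGeneric cs K f ↔
      (∀ t ∈ innerRefl cs K,
        f (posRoot cs t) ≠ 0 ∧ f (posRoot cs t) ≠ 1 ∧ f (posRoot cs t) ≠ -1) ∧
      (∀ t ∈ boundaryRefl cs K, f (posRoot cs t) = 1 ∨ f (posRoot cs t) = -1) ∧
      (∀ w ∈ K, ∀ i j, M i j = 3 → w * cs.simple i ∉ K → w * cs.simple j ∉ K →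
        f (posRoot cs (w * cs.simple i * w⁻¹)) = f (posRoot cs (w * cs.simple j * w⁻¹))) := by
  constructor
  · rintro ⟨a, b, c⟩
    refine ⟨a, b, fun w hw i j hm hi hj => ?_⟩
    have := c w hw i j hm hi hj
    rwa [stepSign_eq_one cs hK h1 hw hi, stepSign_eq_one cs hK h1 hw hj, one_mul,
      one_mul] at this
  · rintro ⟨a, b, c⟩
    refine ⟨a, b, fun w hw i j hm hi hj => ?_⟩
    rw [stepSign_eq_one cs hK h1 hw hi, stepSign_eq_one cs hK h1 hw hj, one_mul, one_mul]
    exact c w hw i j hm hi hj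

/-- `A_f = {t ∈ T | ⟨f, α_t⟩ ∈ {1, -1}}`. -/
def unitRefl {B W : Type*} [Group W] {M : CoxeterMatrix B} (cs : CoxeterSystem M W)
    (f : Dual ℝ (RootSpace B)) : Set W :=
  {t | cs.IsReflection t ∧ (f (posRoot cs t) = 1 ∨ f (posRoot cs t) = -1)}

/-- `K^f_w`: the set of all `v` with `Des_A(v) = Des_A(w)`, where `A = A_f`. -/
def cell {B W : Type*} [Group W] {M : CoxeterMatrix B} (cs : CoxeterSystem M W)
    (f : Dual ℝ (RootSpace B)) (w : W) : Set W :=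
  {v | des cs (unitRefl cs f) v = des cs (unitRefl cs f) w}

/-- `H_{t,ε} = {f ∈ V* | ⟨f, α_t⟩ = ε}`; it is a basic hyperplane if `t` is a reflection and
`ε = ±1`. -/
def hyperplane {B W : Type*} [Group W] {M : CoxeterMatrix B} (cs : CoxeterSystem M W)
    (t : W) (ε : ℝ) : Set (Dual ℝ (RootSpace B)) :=
  {f | f (posRoot cs t) = ε}

/-- A basic flat is an intersection of (any family of) basic hyperplanes. -/
def IsBasicFlat {B W : Type*} [Group W] {M : CoxeterMatrix B} (cs : CoxeterSystem M W)
    (L : Set (Dual ℝ (RootSpace B))) : Prop :=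
  ∃ I : Set (W × ℝ), (∀ p ∈ I, cs.IsReflection p.1 ∧ (p.2 = 1 ∨ p.2 = -1)) ∧
    L = ⋂ p ∈ I, hyperplane cs p.1 p.2

/-- `A_L`: the reflections `t` such that `L ⊆ H_{t,ε}` for some `ε = ±1`. -/
def flatRefl {B W : Type*} [Group W] {M : CoxeterMatrix B} (cs : CoxeterSystem M W)
    (L : Set (Dual ℝ (RootSpace B))) : Set W :=
  {t | cs.IsReflection t ∧ ∃ ε : ℝ, (ε = 1 ∨ ε = -1) ∧ L ⊆ hyperplane cs t ε}

/-- The `L`-partition of `W`: all sets `W_A^D = {w | Des_A(w) = D}`, `D ⊆ A`, where `A = A_L`.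
(Here empty sets `W_A^D` are listed, too.) -/
def flatPartition {B W : Type*} [Group W] {M : CoxeterMatrix B} (cs : CoxeterSystem M W)
    (L : Set (Dual ℝ (RootSpace B))) : Set (Set W) :=
  {K | ∃ D ⊆ flatRefl cs L, K = {w | des cs (flatRefl cs L) w = D}}

open Classical in
/-- The basis vector `C_w` of the space `V_K` with basis indexed by `K`; zero if `w ∉ K`. -/
def basisVec {W : Type*} (K : Set W) (w : W) : K →₀ ℂ :=
  if h : w ∈ K then Finsupp.single ⟨w, h⟩ 1 else 0

/-- The coefficient `ȧ_t = 1 / ⟨f, α_t⟩`; then `ä_t = -ȧ_t`. -/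
def aDot {B W : Type*} [Group W] {M : CoxeterMatrix B} (cs : CoxeterSystem M W)
    (f : Dual ℝ (RootSpace B)) (t : W) : ℂ :=
  ((1 / f (posRoot cs t) : ℝ) : ℂ)

/-- `b` is a symmetric normalization `ḃ_t = b̈_t = b t` for `f` on `K`:
`ḃ_t b̈_t = (1 - ȧ_t) (1 - ä_t)` for `t ∈ T_K`. The right side may be negative, so `b` takes
complex values; the square roots are only determined up to sign. -/
def IsSymmNormalization {B W : Type*} [Group W] {M : CoxeterMatrix B} (cs : CoxeterSystem M W)
    (f : Dual ℝ (RootSpace B)) (K : Set W) (b : W → ℂ) : Prop :=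
  ∀ t ∈ innerRefl cs K, b t * b t = (1 - aDot cs f t) * (1 - -aDot cs f t)

/-- `ρ` is the abstract Young representation of `W` on `V_K` defined by `f` with the symmetric
normalization `b`: with `t = w s_i w⁻¹`, the generator `s_i` sends `C_w` to
`ȧ_t C_w + b_t C_{w s_i}` if `ℓ(w) < ℓ(w s_i)` and to `ä_t C_w + b_t C_{w s_i}` otherwise, where
`C_{w s_i}` is read as `0` if `w s_i ∉ K`. -/
def IsAYRep {B W : Type*} [Group W] {M : CoxeterMatrix B} (cs : CoxeterSystem M W)
    (f : Dual ℝ (RootSpace B)) (K : Set W) (b : W → ℂ)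
    (ρ : Representation ℂ W (K →₀ ℂ)) : Prop :=
  ∀ w ∈ K, ∀ i, ρ (cs.simple i) (basisVec K w) =
    (if cs.length w < cs.length (w * cs.simple i) then
        aDot cs f (w * cs.simple i * w⁻¹)
      else -aDot cs f (w * cs.simple i * w⁻¹)) • basisVec K w +
      b (w * cs.simple i * w⁻¹) • basisVec K (w * cs.simple i)

end AbstractYoung

end

/-! Put `x = f' - f`. The boundary reflections of `K` belong to `A_L`, so `f` and `f'` agree on them
and `x` vanishes on every wall leading out of `K`. As `K` is finite, crossing inner walls ends in a
chamber of `K` where `x` is dominant, and likewise for `-x` (`exists_dominant_chamber`). A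
reflection outside `T_K` does not separate these two chambers, so `x` is both nonnegative and
nonpositive on its root. Hence `x` is nonzero on finitely many roots only
(`finite_setOf_apply_ne_zero`).

The irreducible components meeting this support contain finitely many roots. The subgroup `N` fixing
all other roots is finite and normal, and a simple reflection either lies in `N` or has its whole
root orbit in the kernel of `x` (`simple_mem_linkedSubgroup_or`). So along the complex line `f + z
x` a generator outside `N` acts by a constant operator, and averaging the identity over `N` alone
intertwines the representations at two parameters, even if `W` is infinite
(`mul_averageOver_youngRep`).

The determinant of this intertwiner is analytic on the generic parameters, which form the complement
of a finite set in `ℂ` and hence a connected set; at equal parameters it is a power of the order of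
`N`. By the identity theorem the representations at `0` and `1` are both isomorphic to the one at a
common third parameter (`nonempty_equiv_youngRep_deform`). Analyticity requires matrix entries
rational in `z`, so this is done with upward weights `1`; a diagonal change of basis leads to the
square roots `b_t` (`exists_isAYRep`). -/

noncomputable section

namespace AbstractYoung

/-! ### Roots, positive roots and lengths for simply laced Coxeter groups. -/

section RootSystem

variable {B W : Type*} [Group W] {M : CoxeterMatrix B} (cs : CoxeterSystem M W)

theorem ne_of_eq_three {i j : B} (h : M i j = 3) : i ≠ j := by
  rintro rfl
  simp at h

theorem simpleCoroot_simpleRoot_of_eq_two {i j : B} (h : M i j = 2) :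
    simpleCoroot M i (simpleRoot j) = 0 := by
  simp [simpleCoroot_simpleRoot, h]

theorem simpleCoroot_simpleRoot_of_eq_three {i j : B} (h : M i j = 3) :
    simpleCoroot M i (simpleRoot j) = -1 := by
  simp [simpleCoroot_simpleRoot, h]

theorem simpleReflection_apply (i : B) (v : RootSpace B) :
    simpleReflection M i v = v - simpleCoroot M i v • simpleRoot i := by
  simp [simpleReflection, Module.reflection_apply]

theorem geomRep_simple (i : B) : geomRep cs (cs.simple i) = simpleReflection M i :=
  cs.lift_apply_simple _ i

theorem geomRep_simple_apply (i : B) (v : RootSpace B) :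
    geomRep cs (cs.simple i) v = v - simpleCoroot M i v • simpleRoot i := by
  rw [geomRep_simple, simpleReflection_apply]

theorem geomRep_mul_apply (u w : W) (v : RootSpace B) :
    geomRep cs (u * w) v = geomRep cs u (geomRep cs w v) := by
  rw [map_mul]; rfl

theorem geomRep_one_apply (v : RootSpace B) : geomRep cs 1 v = v := by
  rw [map_one]; rfl

theorem geomRep_inv_apply_self (w : W) (v : RootSpace B) :
    geomRep cs w⁻¹ (geomRep cs w v) = v := by
  rw [← geomRep_mul_apply, inv_mul_cancel, geomRep_one_apply]

theorem geomRep_apply_inv_self (w : W) (v : RootSpace B) :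
    geomRep cs w (geomRep cs w⁻¹ v) = v := by
  rw [← geomRep_mul_apply, mul_inv_cancel, geomRep_one_apply]

/-- The standard symmetric bilinear form of the root space, scaled so that simple roots have
square length `2`. -/
def rootForm (M : CoxeterMatrix B) : RootSpace B →ₗ[ℝ] Dual ℝ (RootSpace B) :=
  Finsupp.linearCombination ℝ (simpleCoroot M)

theorem rootForm_simpleRoot (i : B) : rootForm M (simpleRoot i) = simpleCoroot M i := by
  simp [rootForm, simpleRoot]

theorem rootForm_comm (u v : RootSpace B) : rootForm M u v = rootForm M v u := by
  have : rootForm M = (rootForm M).flip := by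
    ext i j
    change rootForm M (simpleRoot i) (simpleRoot j) = rootForm M (simpleRoot j) (simpleRoot i)
    rw [rootForm_simpleRoot, rootForm_simpleRoot, simpleCoroot_simpleRoot,
      simpleCoroot_simpleRoot, M.symmetric]
  exact congrArg (fun F => F u v) this

theorem rootForm_geomRep (w : W) (u v : RootSpace B) :
    rootForm M (geomRep cs w u) (geomRep cs w v) = rootForm M u v := by
  induction w using cs.simple_induction_left generalizing u v with
  | one => simp only [geomRep_one_apply]
  | mul_simple_left w i ih =>
    rw [geomRep_mul_apply, geomRep_mul_apply, ← ih u v]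
    generalize geomRep cs w u = u
    generalize geomRep cs w v = v
    have h1 : rootForm M u (simpleRoot i) = simpleCoroot M i u := by
      rw [rootForm_comm, rootForm_simpleRoot]
    simp only [geomRep_simple_apply, map_sub, map_smul, LinearMap.sub_apply, LinearMap.smul_apply,
      rootForm_simpleRoot, h1, simpleCoroot_self, smul_eq_mul]
    ring

/-- The root `w α_i`. -/
def root (w : W) (i : B) : RootSpace B := geomRep cs w (simpleRoot i)

theorem root_one (i : B) : root cs 1 i = simpleRoot i := geomRep_one_apply cs _

theorem geomRep_root (u w : W) (i : B) : geomRep cs u (root cs w i) = root cs (u * w) i :=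
  (geomRep_mul_apply cs u w _).symm

theorem rootForm_root_self (w : W) (i : B) : rootForm M (root cs w i) (root cs w i) = 2 := by
  rw [root, rootForm_geomRep, rootForm_simpleRoot, simpleCoroot_self]

theorem root_mul_simple_self (w : W) (i : B) : root cs (w * cs.simple i) i = -root cs w i := by
  rw [root, geomRep_mul_apply, geomRep_simple_apply, simpleCoroot_self, root, ← map_neg]
  congr 1
  module

theorem root_mul_simple_of_eq_two (w : W) {i j : B} (h : M i j = 2) :
    root cs (w * cs.simple i) j = root cs w j := by
  rw [root, geomRep_mul_apply, geomRep_simple_apply, simpleCoroot_simpleRoot_of_eq_two h, root,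
    zero_smul, sub_zero]

theorem root_mul_simple_of_eq_three (w : W) {i j : B} (h : M i j = 3) :
    root cs (w * cs.simple i) j = root cs w i + root cs w j := by
  rw [root, geomRep_mul_apply, geomRep_simple_apply, simpleCoroot_simpleRoot_of_eq_three h, root,
    root, ← map_add]
  congr 1
  module

theorem geomRep_reflection_apply (w : W) (i : B) (v : RootSpace B) :
    geomRep cs (w * cs.simple i * w⁻¹) v = v - rootForm M (root cs w i) v • root cs w i := by
  have h : rootForm M (root cs w i) v = simpleCoroot M i (geomRep cs w⁻¹ v) := by
    rw [← rootForm_simpleRoot, ← rootForm_geomRep cs w (simpleRoot i), geomRep_apply_inv_self, root]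
  rw [geomRep_mul_apply, geomRep_mul_apply, geomRep_simple_apply, map_sub, map_smul,
    geomRep_apply_inv_self, h, root]

theorem simple_mul_simple_comm {i j : B} (h : M i j = 2) :
    cs.simple i * cs.simple j = cs.simple j * cs.simple i := by
  have h1 := cs.simple_mul_simple_pow i j
  rw [h, pow_two] at h1
  have h2 := eq_inv_of_mul_eq_one_left h1
  simpa using h2

theorem simple_braid {i j : B} (h : M i j = 3) :
    cs.simple i * cs.simple j * cs.simple i = cs.simple j * cs.simple i * cs.simple j := by
  have h1 := cs.simple_mul_simple_pow i j
  have h2 : (cs.simple i * cs.simple j * cs.simple i) *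
      (cs.simple j * cs.simple i * cs.simple j) = 1 := by
    rw [← h1, h]
    simp only [pow_succ, pow_zero, one_mul, mul_assoc]
  have h3 := eq_inv_of_mul_eq_one_left h2
  simpa [mul_assoc] using h3

/-- Strip a right descent `j` from `w` and use the rank two relations of `i` and `j` to write the
root through roots of shorter elements. -/
theorem root_nonneg (hM : IsSimplyLaced M) (w : W) (i : B)
    (h : cs.length w < cs.length (w * cs.simple i)) (k : B) : 0 ≤ root cs w i k := by
  induction hn : cs.length w using Nat.strong_induction_on generalizing w i with
  | _ n IH =>
    subst hn
    by_cases hw : w = 1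
    · subst hw
      rw [root_one, simpleRoot]
      exact Finsupp.single_nonneg.2 zero_le_one k
    obtain ⟨j, hj⟩ := cs.exists_rightDescent_of_ne_one hw
    rw [cs.isRightDescent_iff] at hj
    have hij : i ≠ j := by rintro rfl; omega
    have hv : w = w * cs.simple j * cs.simple j := by simp
    have hwi := cs.length_mul_simple w i
    set v := w * cs.simple j with hvdef
    rw [hv] at h hwi hj ⊢
    have hvi := cs.length_mul_simple v i
    rw [hv] at IH
    rcases hM i j hij with h2 | h3
    · have h2' : M j i = 2 := by rw [M.symmetric, h2]
      rw [root_mul_simple_of_eq_two cs v h2']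
      apply IH (cs.length v) (by omega) v i _ rfl
      by_contra hlt
      have h4 := cs.length_mul_simple (v * cs.simple i) j
      rw [mul_assoc, simple_mul_simple_comm cs h2, ← mul_assoc] at h4
      omega
    · have h3' : M j i = 3 := by rw [M.symmetric, h3]
      by_cases hvi' : cs.length v < cs.length (v * cs.simple i)
      · rw [root_mul_simple_of_eq_three cs v h3', Finsupp.add_apply]
        exact add_nonneg (IH (cs.length v) (by omega) v j (by omega) rfl)
          (IH (cs.length v) (by omega) v i hvi' rfl)
      -- Here `w = u s_i s_j` with `ℓ(u) = ℓ(w) - 2`, and `w s_i = u s_j s_i s_j` by the braid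
      -- relation. Since `ℓ(w s_i) = ℓ(u) + 3`, the step from `u` to `u s_j` must go up.
      · have hu : v = v * cs.simple i * cs.simple i := by simp
        set u := v * cs.simple i with hudef
        have hroot : root cs (v * cs.simple j) i = root cs u j := by
          rw [root_mul_simple_of_eq_three cs v h3', hudef, root_mul_simple_of_eq_three cs v h3,
            add_comm]
        rw [hroot]
        apply IH (cs.length u) (by omega) u j _ rfl
        have h5 := cs.length_mul_simple u j
        have h6 := cs.length_mul_simple (u * cs.simple j) i
        have h7 := cs.length_mul_simple (u * cs.simple j * cs.simple i) j
        have h8 : u * cs.simple j * cs.simple i * cs.simple j =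
            v * cs.simple j * cs.simple i := by
          conv_rhs => rw [hu]
          simp only [mul_assoc]
          rw [← mul_assoc (cs.simple i), simple_braid cs h3]
          simp only [mul_assoc]
        rw [h8] at h7
        omega

theorem root_nonpos (hM : IsSimplyLaced M) (w : W) (i : B)
    (h : cs.length (w * cs.simple i) < cs.length w) (k : B) : root cs w i k ≤ 0 := by
  have := root_nonneg cs hM (w * cs.simple i) i (by simpa using h) k
  rw [root_mul_simple_self, Finsupp.neg_apply] at this
  linarith

/-- The set of all roots `w α_i`. -/
def rootSet : Set (RootSpace B) := {β | ∃ w i, β = root cs w i}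

/-- The set of positive roots. -/
def posRootSet : Set (RootSpace B) := {β | β ∈ rootSet cs ∧ ∀ j, 0 ≤ β j}

variable {cs}

theorem root_mem_rootSet (w : W) (i : B) : root cs w i ∈ rootSet cs := ⟨w, i, rfl⟩

theorem geomRep_mem_rootSet (w : W) {β : RootSpace B} (hβ : β ∈ rootSet cs) :
    geomRep cs w β ∈ rootSet cs := by
  obtain ⟨u, i, rfl⟩ := hβ
  exact ⟨w * u, i, geomRep_root cs w u i⟩

theorem neg_mem_rootSet {β : RootSpace B} (hβ : β ∈ rootSet cs) : -β ∈ rootSet cs := by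
  obtain ⟨u, i, rfl⟩ := hβ
  exact ⟨u * cs.simple i, i, (root_mul_simple_self cs u i).symm⟩

theorem rootForm_self {β : RootSpace B} (hβ : β ∈ rootSet cs) : rootForm M β β = 2 := by
  obtain ⟨u, i, rfl⟩ := hβ
  exact rootForm_root_self cs u i

theorem ne_zero_of_mem_rootSet {β : RootSpace B} (hβ : β ∈ rootSet cs) : β ≠ 0 := by
  rintro rfl
  simpa using rootForm_self hβ

theorem mem_posRootSet_or_neg (hM : IsSimplyLaced M) {β : RootSpace B} (hβ : β ∈ rootSet cs) :
    β ∈ posRootSet cs ∨ -β ∈ posRootSet cs := by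
  obtain ⟨u, i, rfl⟩ := id hβ
  rcases (cs.length_mul_simple_ne u i).lt_or_gt with h | h
  · exact Or.inr ⟨neg_mem_rootSet hβ, fun k => by
      have := root_nonpos cs hM u i h k
      rw [Finsupp.neg_apply]; linarith⟩
  · exact Or.inl ⟨hβ, root_nonneg cs hM u i h⟩

theorem neg_notMem_posRootSet {β : RootSpace B} (hβ : β ∈ posRootSet cs) :
    -β ∉ posRootSet cs := by
  intro h
  apply ne_zero_of_mem_rootSet hβ.1
  ext k
  have h1 := hβ.2 k
  have h2 := h.2 k
  rw [Finsupp.neg_apply] at h2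
  rw [Finsupp.zero_apply]
  linarith

theorem neg_mem_posRootSet_iff (hM : IsSimplyLaced M) {β : RootSpace B} (hβ : β ∈ rootSet cs) :
    -β ∈ posRootSet cs ↔ β ∉ posRootSet cs :=
  ⟨fun h h' => neg_notMem_posRootSet h' h, (mem_posRootSet_or_neg hM hβ).resolve_left⟩

theorem simpleRoot_mem_posRootSet (i : B) : (simpleRoot i : RootSpace B) ∈ posRootSet cs :=
  ⟨⟨1, i, (root_one cs i).symm⟩, Finsupp.single_nonneg.2 zero_le_one⟩

theorem root_mem_posRootSet_iff (hM : IsSimplyLaced M) (w : W) (i : B) :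
    root cs w i ∈ posRootSet cs ↔ cs.length w < cs.length (w * cs.simple i) := by
  constructor
  · intro h
    by_contra hlt
    have hlt' := lt_of_le_of_ne (not_lt.1 hlt) (cs.length_mul_simple_ne w i)
    refine neg_notMem_posRootSet h ⟨neg_mem_rootSet h.1, fun k => ?_⟩
    have := root_nonpos cs hM w i hlt' k
    rw [Finsupp.neg_apply]; linarith
  · exact fun h => ⟨root_mem_rootSet w i, root_nonneg cs hM w i h⟩

theorem eq_of_smul_mem_posRootSet {β : RootSpace B} {c : ℝ} (hβ : β ∈ posRootSet cs)
    (hc : c • β ∈ posRootSet cs) : c • β = β := by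
  have h1 := rootForm_self hβ.1
  have h2 := rootForm_self hc.1
  simp only [map_smul, LinearMap.smul_apply, smul_eq_mul, h1] at h2
  have h3 : (c - 1) * (c + 1) = 0 := by linarith
  rcases mul_eq_zero.1 h3 with h | h
  · rw [show c = 1 by linarith, one_smul]
  · have h4 : c = -1 := by linarith
    rw [h4, neg_one_smul] at hc
    exact (neg_notMem_posRootSet hβ hc).elim

/-- The reflection `s_i` changes only the `i`-th coordinate, so a positive root made negative is a
multiple of `α_i`. -/
theorem geomRep_simple_mem_posRootSet (hM : IsSimplyLaced M) (i : B) {β : RootSpace B}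
    (hβ : β ∈ posRootSet cs) (hne : β ≠ simpleRoot i) :
    geomRep cs (cs.simple i) β ∈ posRootSet cs := by
  have hroot := geomRep_mem_rootSet (cs.simple i) hβ.1
  refine (mem_posRootSet_or_neg hM hroot).resolve_right fun hneg => hne ?_
  have key : β = β i • simpleRoot i := by
    ext j
    by_cases hji : j = i
    · subst hji
      simp [simpleRoot]
    · have h1 := hβ.2 j
      have h2 := hneg.2 j
      rw [Finsupp.neg_apply, geomRep_simple_apply] at h2
      simp only [simpleRoot, Finsupp.sub_apply, Finsupp.smul_apply,
        Finsupp.single_eq_of_ne hji, smul_zero, sub_zero] at h2 ⊢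
      linarith
  rw [key]
  exact eq_of_smul_mem_posRootSet (simpleRoot_mem_posRootSet i) (key ▸ hβ)

theorem isPosRoot_iff {t : W} {β : RootSpace B} : IsPosRoot cs t β ↔
    β ∈ posRootSet cs ∧ ∃ w i, t = w * cs.simple i * w⁻¹ ∧ β = root cs w i := by
  constructor
  · rintro ⟨⟨w, i, h, h'⟩, hp⟩
    exact ⟨⟨⟨w, i, h'⟩, hp⟩, w, i, h, h'⟩
  · rintro ⟨hp, h⟩
    exact ⟨h, hp.2⟩

/-- The reflection in `β` negates `γ`, which makes the two roots proportional; square length `2` and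
positivity leave only the factor `1`. -/
theorem IsPosRoot.unique {t : W} {β γ : RootSpace B} (hβ : IsPosRoot cs t β)
    (hγ : IsPosRoot cs t γ) : γ = β := by
  rw [isPosRoot_iff] at hβ hγ
  obtain ⟨hβ, w, i, h1, h2⟩ := hβ
  obtain ⟨hγ, u, j, h3, h4⟩ := hγ
  have e1 : geomRep cs t γ = -γ := by
    rw [h3, geomRep_reflection_apply, ← h4, rootForm_self hγ.1]
    module
  rw [h1, geomRep_reflection_apply, ← h2] at e1
  have e2 : γ = (rootForm M β γ / 2) • β := by
    have : (2 : ℝ) • γ = rootForm M β γ • β := by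
      rw [sub_eq_iff_eq_add] at e1
      rw [two_smul]
      nth_rewrite 2 [e1]
      abel
    rw [div_eq_inv_mul, mul_smul, ← this, smul_smul]
    norm_num
  rw [e2]
  exact eq_of_smul_mem_posRootSet hβ (e2 ▸ hγ)

theorem posRoot_eq {t : W} {β : RootSpace B} (hβ : IsPosRoot cs t β) : posRoot cs t = β :=
  hβ.unique (Classical.epsilon_spec ⟨β, hβ⟩)

theorem posRoot_conj_of_mem {w : W} {i : B} (h : root cs w i ∈ posRootSet cs) :
    posRoot cs (w * cs.simple i * w⁻¹) = root cs w i :=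
  posRoot_eq (isPosRoot_iff.2 ⟨h, w, i, rfl, rfl⟩)

theorem posRoot_conj_of_neg_mem {w : W} {i : B} (h : -root cs w i ∈ posRootSet cs) :
    posRoot cs (w * cs.simple i * w⁻¹) = -root cs w i :=
  posRoot_eq (isPosRoot_iff.2 ⟨h, w * cs.simple i, i, by simp [mul_assoc],
    (root_mul_simple_self cs w i).symm⟩)

theorem isPosRoot_posRoot (hM : IsSimplyLaced M) {t : W} (ht : cs.IsReflection t) :
    IsPosRoot cs t (posRoot cs t) := by
  obtain ⟨w, i, rfl⟩ := ht
  rcases mem_posRootSet_or_neg hM (root_mem_rootSet (cs := cs) w i) with h | h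
  · rw [posRoot_conj_of_mem h]
    exact isPosRoot_iff.2 ⟨h, w, i, rfl, rfl⟩
  · rw [posRoot_conj_of_neg_mem h]
    exact isPosRoot_iff.2
      ⟨h, w * cs.simple i, i, by simp [mul_assoc], (root_mul_simple_self cs w i).symm⟩

theorem posRoot_mem (hM : IsSimplyLaced M) {t : W} (ht : cs.IsReflection t) :
    posRoot cs t ∈ posRootSet cs :=
  (isPosRoot_iff.1 (isPosRoot_posRoot hM ht)).1

theorem exists_posRoot_eq {β : RootSpace B} (hβ : β ∈ posRootSet cs) :
    ∃ t, cs.IsReflection t ∧ posRoot cs t = β := by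
  obtain ⟨w, i, rfl⟩ := hβ.1
  exact ⟨_, ⟨w, i, rfl⟩, posRoot_conj_of_mem hβ⟩

theorem eq_one_of_root_eq (hM : IsSimplyLaced M) {w : W}
    (h : ∀ i, root cs w i = simpleRoot i) : w = 1 := by
  by_contra hw
  obtain ⟨i, hi⟩ := cs.exists_rightDescent_of_ne_one hw
  have h1 : root cs w i ∈ posRootSet cs := h i ▸ simpleRoot_mem_posRootSet i
  rw [root_mem_posRootSet_iff hM] at h1
  exact absurd hi (not_lt.2 h1.le)

theorem geomRep_injective (hM : IsSimplyLaced M) : Function.Injective (geomRep cs) := by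
  rw [injective_iff_map_eq_one]
  intro w hw
  refine eq_one_of_root_eq (cs := cs) hM fun i => ?_
  rw [root, hw]
  rfl

/-- A reflection is determined by its positive root. -/
theorem eq_of_posRoot_eq (hM : IsSimplyLaced M) {t t' : W} (ht : cs.IsReflection t)
    (ht' : cs.IsReflection t') (h : posRoot cs t = posRoot cs t') : t = t' := by
  obtain ⟨-, w, i, h1, h2⟩ := isPosRoot_iff.1 (isPosRoot_posRoot hM ht)
  obtain ⟨-, u, j, h3, h4⟩ := isPosRoot_iff.1 (isPosRoot_posRoot hM ht')
  apply geomRep_injective hM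
  ext1 v
  rw [h1, h3, geomRep_reflection_apply, geomRep_reflection_apply, ← h2, ← h4, h]

theorem posRoot_simple (i : B) : posRoot cs (cs.simple i) = simpleRoot i := by
  have h := posRoot_conj_of_mem (cs := cs) (w := 1) (i := i)
    (by rw [root_one]; exact simpleRoot_mem_posRootSet i)
  rwa [one_mul, inv_one, mul_one, root_one] at h

theorem eq_simple_of_posRoot_eq (hM : IsSimplyLaced M) {t : W} (ht : cs.IsReflection t)
    {i : B} (h : posRoot cs t = simpleRoot i) : t = cs.simple i :=
  eq_of_posRoot_eq hM ht (cs.isReflection_simple i) (h.trans (posRoot_simple i).symm)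

theorem posRoot_simple_conj (hM : IsSimplyLaced M) {t : W} (ht : cs.IsReflection t)
    {i : B} (h : posRoot cs t ≠ simpleRoot i) :
    posRoot cs (cs.simple i * t * cs.simple i) = geomRep cs (cs.simple i) (posRoot cs t) := by
  obtain ⟨hp, w, j, h1, h2⟩ := isPosRoot_iff.1 (isPosRoot_posRoot hM ht)
  refine posRoot_eq (isPosRoot_iff.2 ⟨geomRep_simple_mem_posRootSet hM i hp h,
    cs.simple i * w, j, ?_, ?_⟩)
  · rw [h1]; simp [mul_assoc]
  · rw [h2, geomRep_root]

/-- Strong exchange: reading the word from the left, `t` is conjugated until its root becomes the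
simple root of the current letter; multiplying by `t` deletes that letter. -/
theorem length_wordProd_lt (hM : IsSimplyLaced M) (ω : List B) {t : W}
    (ht : cs.IsReflection t) (h : geomRep cs (cs.wordProd ω)⁻¹ (posRoot cs t) ∉ posRootSet cs) :
    cs.length (t * cs.wordProd ω) < ω.length := by
  induction ω generalizing t with
  | nil =>
    rw [cs.wordProd_nil, inv_one, geomRep_one_apply] at h
    exact absurd (posRoot_mem hM ht) h
  | cons i ω ih =>
    rw [cs.wordProd_cons] at h ⊢
    by_cases hti : posRoot cs t = simpleRoot i
    · rw [eq_simple_of_posRoot_eq hM ht hti, cs.simple_mul_simple_cancel_left]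
      have := cs.length_wordProd_le ω
      rw [List.length_cons]; omega
    · have ht' : cs.IsReflection (cs.simple i * t * cs.simple i) := by
        simpa using ht.conj (cs.simple i)
      have h1 := ih ht' (by
        rwa [posRoot_simple_conj hM ht hti, ← geomRep_mul_apply, ← cs.inv_simple i,
          ← mul_inv_rev])
      have h2 := cs.length_mul_le (cs.simple i) (cs.simple i * t * cs.simple i * cs.wordProd ω)
      rw [cs.length_simple] at h2
      have h3 : cs.simple i * (cs.simple i * t * cs.simple i * cs.wordProd ω) =
          t * (cs.simple i * cs.wordProd ω) := by simp [mul_assoc]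
      rw [h3] at h2
      rw [List.length_cons]; omega

theorem length_reflection_mul_lt_iff (hM : IsSimplyLaced M) {t : W} (ht : cs.IsReflection t)
    (w : W) : cs.length (t * w) < cs.length w ↔
      geomRep cs w⁻¹ (posRoot cs t) ∉ posRootSet cs := by
  have key : ∀ u : W, geomRep cs u⁻¹ (posRoot cs t) ∉ posRootSet cs →
      cs.length (t * u) < cs.length u := by
    intro u hu
    obtain ⟨ω, hω, rfl⟩ := cs.exists_isReduced u
    rw [hω.eq]
    exact length_wordProd_lt hM ω ht hu
  refine ⟨fun h hpos => ?_, key w⟩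
  -- A root not inverted by `w` is inverted by `t w`, so `t (t w) = w` would be shorter than `t w`.
  have h1 := key (t * w) (by
    obtain ⟨-, u, j, h1, h2⟩ := isPosRoot_iff.1 (isPosRoot_posRoot hM ht)
    have h3 : geomRep cs t (posRoot cs t) = -posRoot cs t := by
      conv_lhs => rw [h1, geomRep_reflection_apply, ← h1, ← h2,
        rootForm_self (posRoot_mem hM ht).1]
      module
    rw [mul_inv_rev, ht.inv, geomRep_mul_apply, h3, map_neg]
    exact neg_notMem_posRootSet hpos)
  rw [← mul_assoc, ht.mul_self, one_mul] at h1
  omega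

end RootSystem

/-! ### Convex cells, and functionals vanishing on their walls. -/

section Convex

variable {B W : Type*} [Group W] {M : CoxeterMatrix B} {cs : CoxeterSystem M W}

theorem stepSign_smul_posRoot (hM : IsSimplyLaced M) (w : W) (i : B) :
    stepSign cs w i • posRoot cs (w * cs.simple i * w⁻¹) = root cs w i := by
  unfold stepSign
  split_ifs with h
  · rw [one_smul, posRoot_conj_of_mem ((root_mem_posRootSet_iff hM w i).2 h)]
  · have h1 := mt (root_mem_posRootSet_iff hM w i).1 h
    rw [posRoot_conj_of_neg_mem ((neg_mem_posRootSet_iff hM (root_mem_rootSet w i)).2 h1)]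
    module

theorem isReflection_conj (w : W) (i : B) : cs.IsReflection (w * cs.simple i * w⁻¹) :=
  ⟨w, i, rfl⟩

theorem mem_des_iff (hM : IsSimplyLaced M) {A : Set W} (hA : ∀ t ∈ A, cs.IsReflection t)
    {t w : W} : t ∈ des cs A w ↔ t ∈ A ∧ geomRep cs w⁻¹ (posRoot cs t) ∉ posRootSet cs := by
  refine and_congr_right fun h => ?_
  exact length_reflection_mul_lt_iff hM (hA t h) w

/-- Only the reflection `w s w⁻¹` separates `w` from `w s`. -/
theorem eq_conj_of_separates (hM : IsSimplyLaced M) {t : W} (ht : cs.IsReflection t) {w : W}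
    {i : B} (h : ¬(geomRep cs w⁻¹ (posRoot cs t) ∈ posRootSet cs ↔
      geomRep cs (w * cs.simple i)⁻¹ (posRoot cs t) ∈ posRootSet cs)) :
    t = w * cs.simple i * w⁻¹ := by
  have hroot := geomRep_mem_rootSet w⁻¹ (posRoot_mem hM ht).1
  apply eq_of_posRoot_eq hM ht (isReflection_conj w i)
  rw [mul_inv_rev, cs.inv_simple, geomRep_mul_apply] at h
  by_cases hp : geomRep cs w⁻¹ (posRoot cs t) ∈ posRootSet cs
  · have h1 : geomRep cs w⁻¹ (posRoot cs t) = simpleRoot i := by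
      by_contra hne
      exact h (iff_of_true hp (geomRep_simple_mem_posRootSet hM i hp hne))
    have h2 : posRoot cs t = root cs w i := by
      rw [root, ← h1, geomRep_apply_inv_self]
    rw [h2, posRoot_conj_of_mem (h2 ▸ posRoot_mem hM ht)]
  · have hn := (neg_mem_posRootSet_iff hM hroot).2 hp
    have h1 : -geomRep cs w⁻¹ (posRoot cs t) = simpleRoot i := by
      by_contra hne
      have h3 := geomRep_simple_mem_posRootSet hM i hn hne
      rw [map_neg, neg_mem_posRootSet_iff hM (geomRep_mem_rootSet _ hroot)] at h3
      exact h (iff_of_false hp h3)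
    have h2 : posRoot cs t = -root cs w i := by
      rw [root, ← h1, map_neg, geomRep_apply_inv_self, neg_neg]
    rw [h2, posRoot_conj_of_neg_mem (h2 ▸ posRoot_mem hM ht)]

/-- Follow a geodesic from `u` to `v`, which convexity keeps inside `K`, until `p` fails. -/
theorem IsConvex.exists_step {K : Set W} (hK : IsConvex cs K) (p : W → Prop) {u v : W}
    (hu : u ∈ K) (hv : v ∈ K) (hpu : p u) (hpv : ¬p v) :
    ∃ w ∈ K, ∃ i, w * cs.simple i ∈ K ∧ p w ∧ ¬p (w * cs.simple i) := by
  induction hn : cs.length (u⁻¹ * v) generalizing u with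
  | zero =>
    rw [cs.length_eq_zero_iff, inv_mul_eq_one] at hn
    exact absurd (hn ▸ hpu) hpv
  | succ n ih =>
    obtain ⟨i, hi⟩ := cs.exists_leftDescent_of_ne_one (w := u⁻¹ * v) (by
      intro h; rw [h, cs.length_one] at hn; omega)
    rw [cs.isLeftDescent_iff] at hi
    have h1 : (u * cs.simple i)⁻¹ * v = cs.simple i * (u⁻¹ * v) := by simp [mul_assoc]
    have hmem : u * cs.simple i ∈ K := by
      apply hK u hu v hv
      rw [h1, inv_mul_cancel_left, cs.length_simple]
      omega
    by_cases hp : p (u * cs.simple i)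
    · exact ih hmem hp (by rw [h1]; omega)
    · exact ⟨u, hu, i, hmem, hpu, hp⟩

theorem IsConvex.mem_innerRefl_of_separates (hM : IsSimplyLaced M) {K : Set W}
    (hK : IsConvex cs K) {t : W} (ht : cs.IsReflection t) {u v : W} (hu : u ∈ K) (hv : v ∈ K)
    (h : ¬(geomRep cs u⁻¹ (posRoot cs t) ∈ posRootSet cs ↔
      geomRep cs v⁻¹ (posRoot cs t) ∈ posRootSet cs)) : t ∈ innerRefl cs K := by
  wlog hpu : geomRep cs u⁻¹ (posRoot cs t) ∈ posRootSet cs generalizing u v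
  · exact this hv hu (fun h' => h h'.symm) (by tauto)
  have hpv : geomRep cs v⁻¹ (posRoot cs t) ∉ posRootSet cs := by tauto
  obtain ⟨w, hw, i, hi, h1, h2⟩ := hK.exists_step
    (fun w => geomRep cs w⁻¹ (posRoot cs t) ∈ posRootSet cs) hu hv hpu hpv
  exact ⟨w, hw, i, hi, eq_conj_of_separates hM ht (fun h' => h2 (h'.1 h1))⟩

theorem innerRefl_finite {K : Set W} (hfin : K.Finite) : (innerRefl cs K).Finite := by
  refine ((hfin.prod hfin).image fun p => p.1 * p.2⁻¹).subset ?_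
  rintro t ⟨w, hw, i, hi, rfl⟩
  exact ⟨(w * cs.simple i, w), ⟨hi, hw⟩, rfl⟩

theorem isReflection_of_mem_innerRefl {K : Set W} {t : W} (ht : t ∈ innerRefl cs K) :
    cs.IsReflection t := by
  obtain ⟨w, -, i, -, rfl⟩ := ht
  exact isReflection_conj w i

/-- Since `A_L ⊆ A_f`, the cells of `f` refine the `L`-partition. Conversely, a reflection
separating two elements of `K` is inner, where `f` avoids `±1`, so no element of `A_f` cuts `K`. -/
theorem IsGeneric.cell_eq (hM : IsSimplyLaced M) {L : Set (Dual ℝ (RootSpace B))} {K : Set W}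
    (hK : K ∈ flatPartition cs L) (hconv : IsConvex cs K) {f : Dual ℝ (RootSpace B)}
    (hf : f ∈ L) (hgen : IsGeneric cs K f) {v : W} (hv : v ∈ K) : cell cs f v = K := by
  obtain ⟨D, -, hKD⟩ := hK
  have hA : ∀ t ∈ unitRefl cs f, cs.IsReflection t := fun t ht => ht.1
  have hsub : flatRefl cs L ⊆ unitRefl cs f := by
    rintro t ⟨ht, ε, hε, hL⟩
    have h1 : f (posRoot cs t) = ε := hL hf
    exact ⟨ht, h1 ▸ hε⟩
  ext u
  constructor
  · intro hu
    have hu' : des cs (unitRefl cs f) u = des cs (unitRefl cs f) v := hu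
    have hvD : des cs (flatRefl cs L) v = D := by rw [hKD] at hv; exact hv
    rw [hKD]
    change des cs (flatRefl cs L) u = D
    rw [← hvD]
    ext t
    have h2 := Set.ext_iff.1 hu' t
    refine and_congr_right fun ht => ?_
    simpa [des, hsub ht] using h2
  · intro hu
    change des cs (unitRefl cs f) u = des cs (unitRefl cs f) v
    ext t
    rw [mem_des_iff hM hA, mem_des_iff hM hA]
    refine and_congr_right fun ht => not_congr ?_
    by_contra h
    have h1 := hgen.inner t (hconv.mem_innerRefl_of_separates hM ht.1 hu hv h)
    rcases ht.2 with h2 | h2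
    · exact h1.2.1 h2
    · exact h1.2.2 h2

/-- Leaving `K` changes the `A_L`-descent set, while a single step changes the side of only one
reflection. -/
theorem boundaryRefl_subset_flatRefl (hM : IsSimplyLaced M) {L : Set (Dual ℝ (RootSpace B))}
    {K : Set W} (hK : K ∈ flatPartition cs L) : boundaryRefl cs K ⊆ flatRefl cs L := by
  obtain ⟨D, -, rfl⟩ := hK
  rintro _ ⟨w, hw, i, hi, rfl⟩
  have hA : ∀ t ∈ flatRefl cs L, cs.IsReflection t := fun t ht => ht.1
  obtain ⟨t, ht⟩ : ∃ t, ¬(t ∈ des cs (flatRefl cs L) w ↔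
      t ∈ des cs (flatRefl cs L) (w * cs.simple i)) := by
    by_contra! h
    exact hi ((Set.ext h).symm.trans hw)
  rw [mem_des_iff hM hA, mem_des_iff hM hA] at ht
  have htA : t ∈ flatRefl cs L := by tauto
  rwa [← eq_conj_of_separates hM (hA t htA) (w := w) (i := i) (by tauto)]

theorem eq_on_boundaryRefl (hM : IsSimplyLaced M) {L : Set (Dual ℝ (RootSpace B))}
    {K : Set W} (hK : K ∈ flatPartition cs L) {f f' : Dual ℝ (RootSpace B)} (hf : f ∈ L)
    (hf' : f' ∈ L) {t : W} (ht : t ∈ boundaryRefl cs K) :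
    f (posRoot cs t) = f' (posRoot cs t) := by
  obtain ⟨-, ε, -, hL⟩ := boundaryRefl_subset_flatRefl hM hK ht
  have h1 : f (posRoot cs t) = ε := hL hf
  have h2 : f' (posRoot cs t) = ε := hL hf'
  rw [h1, h2]

theorem apply_geomRep_nonneg {y : Dual ℝ (RootSpace B)} {w : W}
    (h : ∀ i, 0 ≤ y (root cs w i)) {β : RootSpace B} (hβ : ∀ j, 0 ≤ β j) :
    0 ≤ y (geomRep cs w β) := by
  have h1 : β = β.sum fun i c => c • simpleRoot i := by
    conv_lhs => rw [← Finsupp.sum_single β]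
    simp [simpleRoot]
  rw [h1, map_finsuppSum, map_finsuppSum]
  refine Finset.sum_nonneg fun i _ => ?_
  simp only [map_smul, smul_eq_mul]
  exact mul_nonneg (hβ i) (h i)

/-- A functional which is nonnegative on the outward walls of a finite set `K` is dominant with
respect to some chamber of `K`. -/
theorem exists_dominant_chamber (hM : IsSimplyLaced M) {K : Set W} (hfin : K.Finite)
    (hne : K.Nonempty) {y : Dual ℝ (RootSpace B)}
    (hy : ∀ w ∈ K, ∀ i, w * cs.simple i ∉ K → 0 ≤ y (root cs w i)) :
    ∃ w ∈ K, ∀ i, 0 ≤ y (root cs w i) := by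
  -- The inner reflections with `w` on the wrong side of the wall relative to `y`. At a minimizer of
  -- their number, crossing a wall with negative value would stay in `K` and remove exactly that
  -- wall from the set.
  let S : W → Set W := fun w => {t | t ∈ innerRefl cs K ∧
    ((y (posRoot cs t) < 0 ∧ geomRep cs w⁻¹ (posRoot cs t) ∈ posRootSet cs) ∨
      (0 < y (posRoot cs t) ∧ geomRep cs w⁻¹ (posRoot cs t) ∉ posRootSet cs))}
  have hS : ∀ w, (S w).Finite := fun w => (innerRefl_finite hfin).subset fun t ht => ht.1
  obtain ⟨w, hw, hmin⟩ := Set.exists_min_image K (fun w => (S w).ncard) hfin hne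
  refine ⟨w, hw, fun i => ?_⟩
  by_contra! hlt
  have hi : w * cs.simple i ∈ K := by
    by_contra hi
    exact absurd (hy w hw i hi) (not_le.2 hlt)
  have hback : w * cs.simple i * cs.simple i = w := by simp
  have htw : w * cs.simple i * w⁻¹ ∈ S w ∧ w * cs.simple i * w⁻¹ ∉ S (w * cs.simple i) := by
    have hmem : w * cs.simple i * w⁻¹ ∈ innerRefl cs K := ⟨w, hw, i, hi, rfl⟩
    have e1 : geomRep cs w⁻¹ (root cs w i) = simpleRoot i := geomRep_inv_apply_self cs w _
    have e2 : geomRep cs (w * cs.simple i)⁻¹ (root cs w i) = -simpleRoot i := by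
      rw [← neg_neg (root cs w i), ← root_mul_simple_self, map_neg]
      exact congrArg _ (geomRep_inv_apply_self cs _ _)
    have h3 := simpleRoot_mem_posRootSet (cs := cs) i
    have h4 := neg_notMem_posRootSet h3
    rcases mem_posRootSet_or_neg hM (root_mem_rootSet (cs := cs) w i) with h | h
    · simp only [S, Set.mem_ofPred_eq, posRoot_conj_of_mem h, e1, e2, hmem, hlt, h3, h4,
        hlt.not_gt]
      tauto
    · have hlt' : 0 < y (-root cs w i) := by rw [map_neg]; linarith
      simp only [S, Set.mem_ofPred_eq, posRoot_conj_of_neg_mem h, map_neg _ (root cs w i), e1, e2,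
        neg_neg, hmem, h3, h4, not_true_eq_false, not_false_eq_true]
      rw [map_neg] at hlt'
      simp [hlt', hlt'.not_gt]
  have hss : S (w * cs.simple i) ⊂ S w := by
    refine Set.ssubset_iff_of_subset ?_ |>.2 ⟨_, htw⟩
    intro t ht
    by_cases h : t = w * cs.simple i * w⁻¹
    · exact h ▸ htw.1
    · have h5 := mt (eq_conj_of_separates hM (isReflection_of_mem_innerRefl ht.1)) h
      rw [not_not] at h5
      change t ∈ innerRefl cs K ∧ _
      rw [h5]
      exact ht
  exact absurd (Set.ncard_lt_ncard hss (hS w)) (not_lt.2 (hmin _ hi))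

/-- Dominant chambers in `K` for `x` and for `-x` lie on the same side of `t`, which bounds the
value by zero from both directions. -/
theorem apply_posRoot_eq_zero (hM : IsSimplyLaced M) {K : Set W} (hfin : K.Finite)
    (hne : K.Nonempty) (hconv : IsConvex cs K) {x : Dual ℝ (RootSpace B)}
    (hx : ∀ t ∈ boundaryRefl cs K, x (posRoot cs t) = 0) {t : W} (ht : cs.IsReflection t)
    (htK : t ∉ innerRefl cs K) : x (posRoot cs t) = 0 := by
  have hwall : ∀ w ∈ K, ∀ i, w * cs.simple i ∉ K → x (root cs w i) = 0 := by
    intro w hw i hi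
    rw [← stepSign_smul_posRoot hM, map_smul, hx _ ⟨w, hw, i, hi, rfl⟩, smul_zero]
  obtain ⟨w, hw, h1⟩ := exists_dominant_chamber hM hfin hne (y := x)
    fun w hw i hi => (hwall w hw i hi).ge
  obtain ⟨w', hw', h2⟩ := exists_dominant_chamber hM hfin hne (y := -x)
    fun w hw i hi => by rw [LinearMap.neg_apply, hwall w hw i hi, neg_zero]
  have hsame := mt (hconv.mem_innerRefl_of_separates hM ht hw hw') htK
  rw [not_not] at hsame
  by_cases hp : geomRep cs w⁻¹ (posRoot cs t) ∈ posRootSet cs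
  · have h3 := apply_geomRep_nonneg h1 hp.2
    have h4 := apply_geomRep_nonneg h2 (hsame.1 hp).2
    rw [geomRep_apply_inv_self] at h3 h4
    rw [LinearMap.neg_apply] at h4
    linarith
  · have hr := (posRoot_mem hM ht).1
    have hp' := (neg_mem_posRootSet_iff hM (geomRep_mem_rootSet _ hr)).2 hp
    have hp'' := (neg_mem_posRootSet_iff hM (geomRep_mem_rootSet _ hr)).2 (mt hsame.2 hp)
    have h3 := apply_geomRep_nonneg h1 hp'.2
    have h4 := apply_geomRep_nonneg h2 hp''.2
    rw [map_neg, geomRep_apply_inv_self, map_neg] at h3 h4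
    rw [LinearMap.neg_apply] at h4
    linarith

theorem finite_setOf_apply_ne_zero (hM : IsSimplyLaced M) {K : Set W} (hfin : K.Finite)
    (hne : K.Nonempty) (hconv : IsConvex cs K) {x : Dual ℝ (RootSpace B)}
    (hx : ∀ t ∈ boundaryRefl cs K, x (posRoot cs t) = 0) :
    {β | β ∈ rootSet cs ∧ x β ≠ 0}.Finite := by
  have hpos : ∀ β ∈ posRootSet cs, x β ≠ 0 → β ∈ posRoot cs '' innerRefl cs K := by
    intro β hβ hxβ
    obtain ⟨t, ht, rfl⟩ := exists_posRoot_eq hβ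
    refine ⟨t, ?_, rfl⟩
    by_contra htK
    exact hxβ (apply_posRoot_eq_zero hM hfin hne hconv hx ht htK)
  have hF := (innerRefl_finite (cs := cs) hfin).image (posRoot cs)
  refine (hF.union (hF.image fun β => -β)).subset ?_
  rintro β ⟨hβ, hxβ⟩
  rcases mem_posRootSet_or_neg hM hβ with h | h
  · exact Or.inl (hpos β h hxβ)
  · exact Or.inr ⟨-β, hpos _ h (by rwa [map_neg, neg_ne_zero]), neg_neg β⟩

end Convex

/-! ### The finite normal subgroup attached to the support of `x`. -/

section FiniteComponent

variable {B W : Type*} [Group W] {M : CoxeterMatrix B} {cs : CoxeterSystem M W}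

/-- If `γ` is not orthogonal to `β`, then `y` cannot vanish on both `γ` and its reflection in `β`,
as the two values differ by a nonzero multiple of `y β`. -/
theorem finite_setOf_rootForm_ne_zero {y : Dual ℝ (RootSpace B)}
    (hy : {γ | γ ∈ rootSet cs ∧ y γ ≠ 0}.Finite) {β : RootSpace B} (hβ : β ∈ rootSet cs)
    (hyβ : y β ≠ 0) : {γ | γ ∈ rootSet cs ∧ rootForm M β γ ≠ 0}.Finite := by
  obtain ⟨w, i, rfl⟩ := id hβ
  set t := w * cs.simple i * w⁻¹ with ht
  refine (hy.union (hy.preimage ((geomRep cs t).injective.injOn))).subset ?_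
  rintro γ ⟨hγ, hne⟩
  by_cases h : y γ = 0
  · refine Or.inr ⟨geomRep_mem_rootSet t hγ, ?_⟩
    rw [ht, geomRep_reflection_apply, map_sub, h, map_smul, zero_sub, neg_ne_zero, smul_eq_mul]
    exact mul_ne_zero hne hyβ
  · exact Or.inl ⟨hγ, h⟩

/-- The roots joined to the support of `x` by a chain `β, δ, γ` of successively nonorthogonal
roots. In an arbitrary chain of nonorthogonal roots every two consecutive links can be replaced by
a single one, so this is the union of all irreducible components which meet the support. -/
def linkedRoots (cs : CoxeterSystem M W) (x : Dual ℝ (RootSpace B)) : Set (RootSpace B) :=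
  ⋃ β ∈ {β | β ∈ rootSet cs ∧ x β ≠ 0}, ⋃ δ ∈ {δ | δ ∈ rootSet cs ∧ rootForm M β δ ≠ 0},
    {γ | γ ∈ rootSet cs ∧ rootForm M δ γ ≠ 0}

variable {x : Dual ℝ (RootSpace B)}

theorem mem_linkedRoots {γ : RootSpace B} : γ ∈ linkedRoots cs x ↔
    ∃ β ∈ rootSet cs, x β ≠ 0 ∧ ∃ δ ∈ rootSet cs, rootForm M β δ ≠ 0 ∧
      γ ∈ rootSet cs ∧ rootForm M δ γ ≠ 0 := by
  simp only [linkedRoots, Set.mem_iUnion, Set.mem_ofPred_eq, exists_prop, and_assoc]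

theorem linkedRoots_finite (hx : {β | β ∈ rootSet cs ∧ x β ≠ 0}.Finite) :
    (linkedRoots cs x).Finite := by
  refine hx.biUnion fun β hβ => ?_
  have h1 := finite_setOf_rootForm_ne_zero hx hβ.1 hβ.2
  exact h1.biUnion fun δ hδ => finite_setOf_rootForm_ne_zero h1 hδ.1 hδ.2

theorem mem_linkedRoots_of_apply_ne_zero {β : RootSpace B} (hβ : β ∈ rootSet cs)
    (h : x β ≠ 0) : β ∈ linkedRoots cs x := by
  have h2 : rootForm M β β ≠ 0 := by rw [rootForm_self hβ]; norm_num
  exact mem_linkedRoots.2 ⟨β, hβ, h, β, hβ, h2, hβ, h2⟩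

theorem mem_linkedRoots_of_rootForm_ne_zero {γ η : RootSpace B} (hγ : γ ∈ linkedRoots cs x)
    (hη : η ∈ rootSet cs) (h : rootForm M γ η ≠ 0) : η ∈ linkedRoots cs x := by
  obtain ⟨β, hβ, hxβ, δ, hδ, hβδ, hγ, hδγ⟩ := mem_linkedRoots.1 hγ
  refine mem_linkedRoots.2 ⟨β, hβ, hxβ, ?_⟩
  by_cases h1 : rootForm M δ η = 0
  · by_cases h2 : rootForm M β γ = 0
    -- In the chain `β, δ, γ, η` neither middle root can be dropped. The reflection of `γ` in `δ`
    -- replaces both: its pairing with `β` comes from its `δ` term, that with `η` from its `γ` term.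
    · obtain ⟨w, i, hwi⟩ := id hδ
      have h3 := geomRep_mem_rootSet (w * cs.simple i * w⁻¹) hγ
      rw [geomRep_reflection_apply, ← hwi] at h3
      refine ⟨_, h3, ?_, hη, ?_⟩
      · rw [map_sub, map_smul, h2, zero_sub, neg_ne_zero, smul_eq_mul]
        exact mul_ne_zero hδγ hβδ
      · rw [map_sub, map_smul, LinearMap.sub_apply, LinearMap.smul_apply, h1, smul_zero, sub_zero]
        exact h
    · exact ⟨γ, hγ, h2, hη, h⟩
  · exact ⟨δ, hδ, hβδ, hη, h1⟩

theorem geomRep_mem_linkedRoots (w : W) {γ : RootSpace B} (hγ : γ ∈ linkedRoots cs x) :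
    geomRep cs w γ ∈ linkedRoots cs x := by
  induction w using cs.simple_induction_left with
  | one => rwa [geomRep_one_apply]
  | mul_simple_left w i ih =>
    rw [geomRep_mul_apply]
    revert ih
    generalize geomRep cs w γ = δ
    intro hδ
    obtain ⟨-, -, -, -, -, -, hδr, -⟩ := mem_linkedRoots.1 hδ
    by_cases h : simpleCoroot M i δ = 0
    · rwa [geomRep_simple_apply, h, zero_smul, sub_zero]
    · have hi : (simpleRoot i : RootSpace B) ∈ rootSet cs := (simpleRoot_mem_posRootSet i).1
      have h1 := mem_linkedRoots_of_rootForm_ne_zero hδ hi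
        (by rwa [rootForm_comm, rootForm_simpleRoot])
      refine mem_linkedRoots_of_rootForm_ne_zero h1 (geomRep_mem_rootSet _ hδr) ?_
      rw [rootForm_simpleRoot, geomRep_simple_apply, map_sub, map_smul, simpleCoroot_self,
        smul_eq_mul]
      intro h2
      apply h
      linarith

/-- The pointwise stabilizer of the roots outside of `linkedRoots cs x`. -/
def linkedSubgroup (cs : CoxeterSystem M W) (x : Dual ℝ (RootSpace B)) : Subgroup W where
  carrier := {w | ∀ γ ∈ rootSet cs, γ ∉ linkedRoots cs x → geomRep cs w γ = γ}
  one_mem' := fun γ _ _ => geomRep_one_apply cs γ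
  mul_mem' := fun {u w} hu hw γ h1 h2 => by rw [geomRep_mul_apply, hw γ h1 h2, hu γ h1 h2]
  inv_mem' := fun {w} hw γ h1 h2 => by
    nth_rewrite 1 [← hw γ h1 h2]
    exact geomRep_inv_apply_self cs w γ

theorem linkedSubgroup_normal : (linkedSubgroup cs x).Normal where
  conj_mem n hn g := by
    intro γ h1 h2
    rw [geomRep_mul_apply, geomRep_mul_apply, hn _ (geomRep_mem_rootSet _ h1),
      geomRep_apply_inv_self]
    intro h3
    apply h2
    rw [← geomRep_apply_inv_self cs g γ]
    exact geomRep_mem_linkedRoots g h3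

/-- The subgroup acts faithfully on the finite set of linked roots, because it fixes all other roots
and the action of `W` on roots is faithful. -/
theorem linkedSubgroup_finite (hM : IsSimplyLaced M)
    (hx : {β | β ∈ rootSet cs ∧ x β ≠ 0}.Finite) : Finite (linkedSubgroup cs x) := by
  have := (linkedRoots_finite hx).to_subtype
  let F : linkedSubgroup cs x → linkedRoots cs x → linkedRoots cs x :=
    fun n γ => ⟨geomRep cs n γ, geomRep_mem_linkedRoots _ γ.2⟩
  refine Finite.of_injective F fun n m hnm => ?_
  have h1 : ∀ γ ∈ rootSet cs, geomRep cs n γ = geomRep cs m γ := by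
    intro γ hγ
    by_cases h : γ ∈ linkedRoots cs x
    · exact congrArg Subtype.val (congrFun hnm ⟨γ, h⟩)
    · rw [n.2 γ hγ h, m.2 γ hγ h]
  have h2 : (m : W)⁻¹ * n = 1 := by
    refine eq_one_of_root_eq (cs := cs) hM fun i => ?_
    rw [root, geomRep_mul_apply, h1 _ (simpleRoot_mem_posRootSet i).1, geomRep_inv_apply_self]
  exact Subtype.ext (inv_mul_eq_one.1 h2).symm

/-- If `α_i` is linked, all unlinked roots are orthogonal to it and fixed by `s_i`. Otherwise its
orbit consists of unlinked roots and misses the support of `x`. -/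
theorem simple_mem_linkedSubgroup_or (i : B) :
    cs.simple i ∈ linkedSubgroup cs x ∨ ∀ w, x (root cs w i) = 0 := by
  by_cases hi : (simpleRoot i : RootSpace B) ∈ linkedRoots cs x
  · refine Or.inl fun γ hγ hγ' => ?_
    have h : simpleCoroot M i γ = 0 := by
      by_contra h
      rw [← rootForm_simpleRoot] at h
      exact hγ' (mem_linkedRoots_of_rootForm_ne_zero hi hγ h)
    rw [geomRep_simple_apply, h, zero_smul, sub_zero]
  · refine Or.inr fun w => ?_
    by_contra h
    apply hi
    rw [← geomRep_inv_apply_self cs w (simpleRoot i)]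
    exact geomRep_mem_linkedRoots _ (mem_linkedRoots_of_apply_ne_zero (root_mem_rootSet w i) h)

end FiniteComponent

/-! ### The Young operators and the Coxeter relations. -/

section YoungOperators

variable {B W : Type*} [Group W] {M : CoxeterMatrix B} {cs : CoxeterSystem M W}

theorem length_simple_mul_simple (hM : IsSimplyLaced M) {i j : B} (hij : i ≠ j) :
    cs.length (cs.simple i * cs.simple j) = 2 := by
  have h1 : root cs (cs.simple i) j ∈ posRootSet cs := by
    refine geomRep_simple_mem_posRootSet hM i (simpleRoot_mem_posRootSet j) fun h => ?_
    exact hij (Finsupp.single_left_injective one_ne_zero h).symm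
  rw [root_mem_posRootSet_iff hM, cs.length_simple] at h1
  have h2 := cs.length_mul_simple (cs.simple i) j
  rw [cs.length_simple] at h2
  omega

theorem root_mul_simple_mul_simple_of_eq_three (w : W) {i j : B} (h : M i j = 3) :
    root cs (w * cs.simple i * cs.simple j) i = root cs w j := by
  rw [root_mul_simple_of_eq_three cs _ (by rw [M.symmetric, h]),
    root_mul_simple_of_eq_three cs _ h, root_mul_simple_self]
  abel

theorem length_braid (hM : IsSimplyLaced M) {i j : B} (h : M i j = 3) :
    cs.length (cs.simple i * cs.simple j * cs.simple i) = 3 := by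
  have h1 := root_mul_simple_mul_simple_of_eq_three (cs := cs) 1 h
  rw [one_mul, root_one] at h1
  have h2 := (root_mem_posRootSet_iff hM (cs.simple i * cs.simple j) i).1
    (h1 ▸ simpleRoot_mem_posRootSet j)
  have h3 := cs.length_mul_simple (cs.simple i * cs.simple j) i
  rw [length_simple_mul_simple hM (ne_of_eq_three h)] at h2 h3
  omega

/-- Used to see that if one of the two rank two paths to an element of `K` stays in `K`, so does the
other. -/
theorem IsConvex.mem_of_mul_simple_mul_simple {K : Set W} (hM : IsSimplyLaced M)
    (hK : IsConvex cs K) {w : W} (hw : w ∈ K) {i j : B} (hij : i ≠ j)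
    (h : w * cs.simple i * cs.simple j ∈ K) : w * cs.simple i ∈ K := by
  apply hK w hw _ h
  simp [mul_assoc, length_simple_mul_simple hM hij]

theorem IsConvex.mem_of_braid {K : Set W} (hM : IsSimplyLaced M)
    (hK : IsConvex cs K) {w : W} (hw : w ∈ K) {i j : B} (hij : M i j = 3)
    (h : w * cs.simple i * cs.simple j * cs.simple i ∈ K) :
    w * cs.simple i * cs.simple j ∈ K := by
  apply hK w hw _ h
  have h1 := length_braid (cs := cs) hM hij
  rw [mul_assoc] at h1
  simp [mul_assoc, length_simple_mul_simple hM (ne_of_eq_three hij), h1]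

/-- `K`-genericity of a complex valued functional, in terms of the roots `w α_i`. -/
structure IsComplexGeneric (cs : CoxeterSystem M W) (K : Set W) (g : RootSpace B →ₗ[ℝ] ℂ) :
    Prop where
  inner : ∀ w ∈ K, ∀ i, w * cs.simple i ∈ K →
    g (root cs w i) ≠ 0 ∧ g (root cs w i) ≠ 1 ∧ g (root cs w i) ≠ -1
  boundary : ∀ w ∈ K, ∀ i, w * cs.simple i ∉ K → g (root cs w i) = 1 ∨ g (root cs w i) = -1
  corner : ∀ w ∈ K, ∀ i j, M i j = 3 → w * cs.simple i ∉ K → w * cs.simple j ∉ K →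
    g (root cs w i) = g (root cs w j)

theorem IsComplexGeneric.ne_zero {K : Set W} {g : RootSpace B →ₗ[ℝ] ℂ}
    (hg : IsComplexGeneric cs K g) {w : W} (hw : w ∈ K) (i : B) : g (root cs w i) ≠ 0 := by
  by_cases hi : w * cs.simple i ∈ K
  · exact (hg.inner w hw i hi).1
  · rcases hg.boundary w hw i hi with h | h <;> rw [h] <;> norm_num

theorem basisVec_of_mem {W : Type*} {K : Set W} {w : W} (hw : w ∈ K) :
    basisVec K w = Finsupp.single ⟨w, hw⟩ 1 := dif_pos hw

theorem basisVec_of_notMem {W : Type*} {K : Set W} {w : W} (hw : w ∉ K) :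
    basisVec K w = 0 := dif_neg hw

theorem linearMap_ext_basisVec {W : Type*} {K : Set W} {V : Type*} [AddCommMonoid V] [Module ℂ V]
    {F G : (K →₀ ℂ) →ₗ[ℂ] V} (h : ∀ w ∈ K, F (basisVec K w) = G (basisVec K w)) : F = G := by
  ext ⟨w, hw⟩
  have := h w hw
  rw [basisVec_of_mem hw] at this
  simpa using this

open Classical in
/-- The weight `1` for a positive and `1 - g(γ)⁻²` for a negative root. -/
def rootWeight (cs : CoxeterSystem M W) (g : RootSpace B →ₗ[ℝ] ℂ) (γ : RootSpace B) : ℂ :=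
  if γ ∈ posRootSet cs then 1 else 1 - (g γ)⁻¹ ^ 2

/-- Only the product of the two weights along an edge matters for the relations. Each weight is
rational in `g γ`, unlike a square root of the product. -/
theorem rootWeight_mul_rootWeight_neg (hM : IsSimplyLaced M) (g : RootSpace B →ₗ[ℝ] ℂ)
    {γ : RootSpace B} (hγ : γ ∈ rootSet cs) :
    rootWeight cs g γ * rootWeight cs g (-γ) = 1 - (g γ)⁻¹ ^ 2 := by
  rcases mem_posRootSet_or_neg hM hγ with h | h
  · rw [rootWeight, rootWeight, if_pos h, if_neg (neg_notMem_posRootSet h), map_neg]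
    ring
  · have h' : γ ∉ posRootSet cs := (neg_mem_posRootSet_iff hM hγ).1 h
    rw [rootWeight, rootWeight, if_pos h, if_neg h', mul_one]

open Classical in
/-- The weight of the step from `w` to `w s_i`; zero if the step does not stay in `K`. -/
def stepWeight (cs : CoxeterSystem M W) (K : Set W) (g : RootSpace B →ₗ[ℝ] ℂ) (w : W) (i : B) :
    ℂ :=
  if w ∈ K ∧ w * cs.simple i ∈ K then rootWeight cs g (root cs w i) else 0

/-- The operator of the generator `s_i` in the normalization where steps up have weight `1`. -/
def youngOp (cs : CoxeterSystem M W) (K : Set W) (g : RootSpace B →ₗ[ℝ] ℂ) (i : B) :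
    (K →₀ ℂ) →ₗ[ℂ] (K →₀ ℂ) :=
  Finsupp.linearCombination ℂ fun w : K =>
    (g (root cs w i))⁻¹ • basisVec K (w : W) +
      stepWeight cs K g w i • basisVec K ((w : W) * cs.simple i)

variable {K : Set W} {g : RootSpace B →ₗ[ℝ] ℂ}

theorem stepWeight_of_mem {w : W} {i : B} (hw : w ∈ K) (hi : w * cs.simple i ∈ K) :
    stepWeight cs K g w i = rootWeight cs g (root cs w i) := if_pos ⟨hw, hi⟩

theorem stepWeight_of_notMem_left {w : W} {i : B} (hw : w ∉ K) : stepWeight cs K g w i = 0 :=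
  if_neg fun h => hw h.1

theorem stepWeight_of_notMem_right {w : W} {i : B} (hi : w * cs.simple i ∉ K) :
    stepWeight cs K g w i = 0 := if_neg fun h => hi h.2

theorem youngOp_basisVec (w : W) (i : B) : youngOp cs K g i (basisVec K w) =
    (g (root cs w i))⁻¹ • basisVec K w +
      stepWeight cs K g w i • basisVec K (w * cs.simple i) := by
  by_cases hw : w ∈ K
  · conv_lhs => rw [basisVec_of_mem hw, youngOp, Finsupp.linearCombination_single, one_smul]
  · rw [basisVec_of_notMem hw, stepWeight_of_notMem_left hw, map_zero, smul_zero, zero_smul,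
      add_zero]

theorem stepWeight_mul_stepWeight (hM : IsSimplyLaced M) {w : W} {i : B} (hw : w ∈ K)
    (hi : w * cs.simple i ∈ K) :
    stepWeight cs K g w i * stepWeight cs K g (w * cs.simple i) i =
      1 - (g (root cs w i))⁻¹ ^ 2 := by
  rw [stepWeight_of_mem hw hi, stepWeight_of_mem hi (by simpa using hw), root_mul_simple_self,
    rootWeight_mul_rootWeight_neg hM g (root_mem_rootSet w i)]

theorem youngOp_mul_self (hM : IsSimplyLaced M) (hg : IsComplexGeneric cs K g) (i : B) :
    youngOp cs K g i * youngOp cs K g i = 1 := by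
  refine linearMap_ext_basisVec fun w hw => ?_
  have h0 : (g (root cs w i))⁻¹ ^ 2 +
      stepWeight cs K g w i * stepWeight cs K g (w * cs.simple i) i = 1 := by
    by_cases hi : w * cs.simple i ∈ K
    · rw [stepWeight_mul_stepWeight hM hw hi]; ring
    · rw [stepWeight_of_notMem_right hi]
      rcases hg.boundary w hw i hi with h | h <;> rw [h] <;> norm_num
  rw [Module.End.mul_apply, Module.End.one_apply]
  simp only [youngOp_basisVec, map_add, map_smul, root_mul_simple_self, map_neg,
    cs.simple_mul_simple_cancel_right, inv_neg]
  linear_combination (norm := module) h0 • basisVec K w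

theorem youngOp_comm (hM : IsSimplyLaced M) (hconv : IsConvex cs K)
    {i j : B} (hij : M i j = 2) :
    youngOp cs K g i * youngOp cs K g j = youngOp cs K g j * youngOp cs K g i := by
  refine linearMap_ext_basisVec fun w hw => ?_
  have hji : M j i = 2 := by rw [M.symmetric, hij]
  have hne : i ≠ j := by rintro rfl; simp at hij
  have hcomm : w * cs.simple j * cs.simple i = w * cs.simple i * cs.simple j := by
    rw [mul_assoc, simple_mul_simple_comm cs hji, mul_assoc]
  have h0 : stepWeight cs K g w i * stepWeight cs K g (w * cs.simple i) j =
      stepWeight cs K g w j * stepWeight cs K g (w * cs.simple j) i := by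
    by_cases h : w * cs.simple i * cs.simple j ∈ K
    · have h' := h
      rw [← hcomm] at h'
      have hi := hconv.mem_of_mul_simple_mul_simple hM hw hne h
      have hj := hconv.mem_of_mul_simple_mul_simple hM hw hne.symm h'
      rw [stepWeight_of_mem hw hi, stepWeight_of_mem hw hj, stepWeight_of_mem hi h,
        stepWeight_of_mem hj h', root_mul_simple_of_eq_two cs w hij,
        root_mul_simple_of_eq_two cs w hji, mul_comm]
    · rw [stepWeight_of_notMem_right h,
        stepWeight_of_notMem_right (w := w * cs.simple j) (hcomm ▸ h), mul_zero, mul_zero]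
  simp only [Module.End.mul_apply, youngOp_basisVec, map_add, map_smul,
    root_mul_simple_of_eq_two cs w hij, root_mul_simple_of_eq_two cs w hji, hcomm]
  linear_combination (norm := module) -h0 • basisVec K (w * cs.simple i * cs.simple j)

theorem youngOp_braid (hM : IsSimplyLaced M) (hconv : IsConvex cs K)
    (hg : IsComplexGeneric cs K g) {i j : B} (hij : M i j = 3) :
    youngOp cs K g i * youngOp cs K g j * youngOp cs K g i =
      youngOp cs K g j * youngOp cs K g i * youngOp cs K g j := by
  refine linearMap_ext_basisVec fun w hw => ?_
  have hji : M j i = 3 := by rw [M.symmetric, hij]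
  have hne : i ≠ j := ne_of_eq_three hij
  have hbraid : w * cs.simple j * cs.simple i * cs.simple j =
      w * cs.simple i * cs.simple j * cs.simple i := by
    have := congrArg (w * ·) (simple_braid cs hji)
    simpa only [mul_assoc] using this
  have ri := root_mul_simple_of_eq_three cs w hij
  have rj := root_mul_simple_of_eq_three cs w hji
  have rij := root_mul_simple_mul_simple_of_eq_three (cs := cs) w hij
  have rji := root_mul_simple_mul_simple_of_eq_three (cs := cs) w hji
  have hx := hg.ne_zero hw i
  have hy := hg.ne_zero hw j
  -- The sum is the value at the `j`-th root of the chamber `w s_i`, hence nonzero when that chamber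
  -- is in `K`.
  have hzi : w * cs.simple i ∈ K → g (root cs w i) + g (root cs w j) ≠ 0 := by
    intro h
    rw [← map_add, ← ri]
    exact hg.ne_zero h j
  have hzj : w * cs.simple j ∈ K → g (root cs w j) + g (root cs w i) ≠ 0 := by
    intro h
    rw [← map_add, ← rj]
    exact hg.ne_zero h i
  have top : stepWeight cs K g w i * stepWeight cs K g (w * cs.simple i) j *
        stepWeight cs K g (w * cs.simple i * cs.simple j) i =
      stepWeight cs K g w j * stepWeight cs K g (w * cs.simple j) i *
        stepWeight cs K g (w * cs.simple j * cs.simple i) j := by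
    by_cases h : w * cs.simple i * cs.simple j * cs.simple i ∈ K
    · have h' := h
      rw [← hbraid] at h'
      have h2 := hconv.mem_of_braid hM hw hij h
      have h2' := hconv.mem_of_braid hM hw hji h'
      have h1 := hconv.mem_of_mul_simple_mul_simple hM hw hne h2
      have h1' := hconv.mem_of_mul_simple_mul_simple hM hw hne.symm h2'
      rw [stepWeight_of_mem hw h1, stepWeight_of_mem h1 h2, stepWeight_of_mem h2 h,
        stepWeight_of_mem hw h1', stepWeight_of_mem h1' h2', stepWeight_of_mem h2' h',
        ri, rj, rij, rji, add_comm (root cs w j)]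
      ring
    · rw [stepWeight_of_notMem_right h,
        stepWeight_of_notMem_right (w := w * cs.simple j * cs.simple i) (hbraid ▸ h), mul_zero,
        mul_zero]
  -- With `p = g (root cs w i)` and `q = g (root cs w j)` this is `1/(pq) = (1/p + 1/q)/(p + q)`,
  -- multiplied by the step weight so that it also holds when the step leaves `K`.
  have side_i : (g (root cs w i))⁻¹ * (g (root cs w j))⁻¹ * stepWeight cs K g w i -
      stepWeight cs K g w i * (g (root cs w i) + g (root cs w j))⁻¹ * (g (root cs w i))⁻¹ =
      (g (root cs w j))⁻¹ * stepWeight cs K g w i * (g (root cs w i) + g (root cs w j))⁻¹ := by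
    by_cases h : w * cs.simple i ∈ K
    · have hz := hzi h
      field_simp
      ring
    · rw [stepWeight_of_notMem_right h]; ring
  have side_j : (g (root cs w j))⁻¹ * (g (root cs w i))⁻¹ * stepWeight cs K g w j -
      stepWeight cs K g w j * (g (root cs w j) + g (root cs w i))⁻¹ * (g (root cs w j))⁻¹ =
      (g (root cs w i))⁻¹ * stepWeight cs K g w j * (g (root cs w j) + g (root cs w i))⁻¹ := by
    by_cases h : w * cs.simple j ∈ K
    · have hz := hzj h
      field_simp
      ring
    · rw [stepWeight_of_notMem_right h]; ring
  -- Inside `K` both sides equal `(1 + 1/(pq))/(p + q)`. On the boundary `1 - p⁻²` or `1 - q⁻²`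
  -- vanishes along with the step weight. If both steps leave `K`, the sum `p + q` might vanish, and
  -- the corner condition `p = q` is needed.
  have bottom : (g (root cs w i))⁻¹ ^ 2 * (g (root cs w j))⁻¹ +
      (stepWeight cs K g w i * stepWeight cs K g (w * cs.simple i) i) *
        (g (root cs w i) + g (root cs w j))⁻¹ =
      (g (root cs w j))⁻¹ ^ 2 * (g (root cs w i))⁻¹ +
      (stepWeight cs K g w j * stepWeight cs K g (w * cs.simple j) j) *
        (g (root cs w j) + g (root cs w i))⁻¹ := by
    by_cases hi : w * cs.simple i ∈ K <;> by_cases hj : w * cs.simple j ∈ K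
    · rw [stepWeight_mul_stepWeight hM hw hi, stepWeight_mul_stepWeight hM hw hj]
      have hz := hzi hi
      rw [add_comm (g (root cs w j))]
      field_simp
      ring
    · rw [stepWeight_mul_stepWeight hM hw hi, stepWeight_of_notMem_right hj]
      have hz := hzi hi
      rcases hg.boundary w hw j hj with h | h <;> rw [h] at hz ⊢ <;> field_simp <;> ring
    · rw [stepWeight_mul_stepWeight hM hw hj, stepWeight_of_notMem_right hi]
      have hz := hzj hj
      rcases hg.boundary w hw i hi with h | h <;> rw [h] at hz ⊢ <;> field_simp <;> ring
    · rw [stepWeight_of_notMem_right hi, stepWeight_of_notMem_right hj,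
        hg.corner w hw i j hij hi hj]
      ring
  simp only [Module.End.mul_apply, youngOp_basisVec, map_add, map_smul, ri, rj, rij, rji, hbraid,
    root_mul_simple_self, map_neg, cs.simple_mul_simple_cancel_right, inv_neg]
  rw [add_comm (g (root cs w j)) (g (root cs w i))] at *
  linear_combination (norm := module) bottom • basisVec K w +
    side_i • basisVec K (w * cs.simple i) -
    side_j • basisVec K (w * cs.simple j) +
    top • basisVec K (w * cs.simple i * cs.simple j * cs.simple i)

theorem youngOp_isLiftable (hM : IsSimplyLaced M) (hconv : IsConvex cs K)
    (hg : IsComplexGeneric cs K g) : M.IsLiftable (youngOp cs K g) := by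
  intro i j
  have hsq := youngOp_mul_self hM hg
  by_cases hij : i = j
  · subst hij
    rw [M.diagonal, pow_one, hsq]
  · rcases hM i j hij with h | h
    · rw [h, pow_two]
      nth_rewrite 2 [youngOp_comm hM hconv h]
      rw [mul_assoc, ← mul_assoc (youngOp cs K g j), hsq, one_mul, hsq]
    · rw [h]
      have h3 : (youngOp cs K g i * youngOp cs K g j) ^ 3 =
          (youngOp cs K g i * youngOp cs K g j * youngOp cs K g i) *
            (youngOp cs K g j * youngOp cs K g i * youngOp cs K g j) := by
        simp only [pow_succ, pow_zero, one_mul, mul_assoc]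
      rw [h3, youngOp_braid hM hconv hg h]
      calc _ = youngOp cs K g j * youngOp cs K g i * (youngOp cs K g j * youngOp cs K g j) *
            (youngOp cs K g i * youngOp cs K g j) := by simp only [mul_assoc]
        _ = youngOp cs K g j * (youngOp cs K g i * youngOp cs K g i) * youngOp cs K g j := by
            rw [hsq, mul_one]; simp only [mul_assoc]
        _ = 1 := by rw [hsq, mul_one, hsq]

/-- The abstract Young representation of a complex generic functional, in the normalization where
steps up have weight `1`. -/
def youngRep (hM : IsSimplyLaced M) (hconv : IsConvex cs K) (hg : IsComplexGeneric cs K g) :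
    Representation ℂ W (K →₀ ℂ) :=
  cs.lift ⟨youngOp cs K g, youngOp_isLiftable hM hconv hg⟩

theorem youngRep_simple (hM : IsSimplyLaced M) (hconv : IsConvex cs K)
    (hg : IsComplexGeneric cs K g) (i : B) :
    youngRep hM hconv hg (cs.simple i) = youngOp cs K g i :=
  cs.lift_apply_simple _ i

end YoungOperators

/-! ### Intertwiners by averaging over a finite subgroup. -/

section Averaging

variable {k G V : Type*} [CommRing k] [Group G] [AddCommGroup V] [Module k V]

/-- The average (up to a scalar) of the identity over a finite subgroup, with respect to two
representations. -/
def averageOver (N : Subgroup G) [Fintype N] (ρ σ : G → Module.End k V) : Module.End k V :=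
  ∑ n : N, σ n * ρ (n : G)⁻¹

theorem mul_averageOver_of_mem (N : Subgroup G) [Fintype N] (ρ σ : Representation k G V) {g : G}
    (hg : g ∈ N) : σ g * averageOver N ρ σ = averageOver N ρ σ * ρ g := by
  rw [averageOver, Finset.mul_sum, Finset.sum_mul]
  refine Fintype.sum_equiv (Equiv.mulLeft ⟨g, hg⟩) _ _ fun n => ?_
  rw [Equiv.coe_mulLeft, Subgroup.coe_mul, mul_assoc, ← map_mul, mul_inv_rev, inv_mul_cancel_right,
    map_mul, mul_assoc]

/-- Conjugation by `g` permutes the summands, since `g` acts equally in both representations. -/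
theorem mul_averageOver_of_eq (N : Subgroup G) [hN : N.Normal] [Fintype N]
    (ρ σ : Representation k G V) {g : G} (hg : σ g = ρ g) :
    σ g * averageOver N ρ σ = averageOver N ρ σ * ρ g := by
  rw [averageOver, Finset.mul_sum, Finset.sum_mul]
  refine Fintype.sum_equiv (MulAut.conjNormal g).toEquiv _ _ fun n => ?_
  have h1 : σ (g * n * g⁻¹) * σ g = σ g * σ n := by
    rw [← map_mul, ← map_mul, inv_mul_cancel_right]
  have h2 : ρ (g * n * g⁻¹)⁻¹ * ρ g = ρ g * ρ (n : G)⁻¹ := by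
    rw [← map_mul, ← map_mul]
    congr 1
    group
  change _ = σ ((MulAut.conjNormal g n : N) : G) * ρ ((MulAut.conjNormal g n : N) : G)⁻¹ * ρ g
  rw [MulAut.conjNormal_apply, mul_assoc, h2, ← mul_assoc, ← mul_assoc, ← h1, hg]

theorem averageOver_self (N : Subgroup G) [Fintype N] (ρ : Representation k G V) :
    averageOver N ρ ρ = (Fintype.card N : k) • (1 : Module.End k V) := by
  have h : ∀ n : N, ρ n * ρ (n : G)⁻¹ = 1 := fun n => by rw [← map_mul, mul_inv_cancel, map_one]
  simp [averageOver, h, Nat.cast_smul_eq_nsmul]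

end Averaging

/-! ### Analytic families of operators. -/

section AnalyticFamilies

variable {ι : Type*}

/-- The matrix entries of the family `F` of operators are analytic on `U`. -/
def IsAnalyticFamily (U : Set ℂ) (F : ℂ → Module.End ℂ (ι →₀ ℂ)) : Prop :=
  ∀ u v : ι, AnalyticOnNhd ℂ (fun z => F z (Finsupp.single u 1) v) U

variable {U : Set ℂ} {F G : ℂ → Module.End ℂ (ι →₀ ℂ)}

theorem isAnalyticFamily_const (A : Module.End ℂ (ι →₀ ℂ)) :
    IsAnalyticFamily U fun _ => A := fun _ _ => analyticOnNhd_const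

theorem IsAnalyticFamily.mul [Fintype ι] (hF : IsAnalyticFamily U F)
    (hG : IsAnalyticFamily U G) : IsAnalyticFamily U fun z => F z * G z := by
  intro u v
  have h : (fun z => (F z * G z) (Finsupp.single u 1) v) =
      fun z => ∑ i : ι, G z (Finsupp.single u 1) i * F z (Finsupp.single i 1) v := by
    funext z
    rw [Module.End.mul_apply]
    generalize G z (Finsupp.single u 1) = a
    have ha : a = ∑ i : ι, a i • Finsupp.single i 1 := by
      conv_lhs => rw [← Finsupp.univ_sum_single a]
      simp
    conv_lhs => rw [ha]
    rw [map_sum, Finsupp.finsetSum_apply]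
    simp only [map_smul, Finsupp.smul_apply, smul_eq_mul]
  rw [h]
  exact Finset.analyticOnNhd_fun_sum _ fun i _ => (hG u i).mul (hF i v)

theorem IsAnalyticFamily.list_prod [Fintype ι] {α : Type*} {F : ℂ → α → Module.End ℂ (ι →₀ ℂ)}
    (hF : ∀ a, IsAnalyticFamily U fun z => F z a) (l : List α) :
    IsAnalyticFamily U fun z => (l.map (F z)).prod := by
  induction l with
  | nil => simpa using isAnalyticFamily_const 1
  | cons a l ih => simpa using (hF a).mul ih

theorem IsAnalyticFamily.sum {α : Type*} {F : α → ℂ → Module.End ℂ (ι →₀ ℂ)} (s : Finset α)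
    (hF : ∀ a, IsAnalyticFamily U (F a)) : IsAnalyticFamily U fun z => ∑ a ∈ s, F a z := by
  intro u v
  simp only [LinearMap.sum_apply, Finsupp.finsetSum_apply]
  exact Finset.analyticOnNhd_fun_sum _ fun a _ => hF a u v

theorem IsAnalyticFamily.det [Fintype ι] (hF : IsAnalyticFamily U F) :
    AnalyticOnNhd ℂ (fun z => LinearMap.det (F z)) U := by
  classical
  simp only [← LinearMap.det_toMatrix (Finsupp.basisSingleOne (R := ℂ) (ι := ι)),
    Matrix.det_apply, LinearMap.toMatrix_apply, Finsupp.coe_basisSingleOne,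
    Finsupp.basisSingleOne_repr, LinearEquiv.refl_apply]
  refine Finset.analyticOnNhd_fun_sum _ fun σ _ => ?_
  have h := Finset.analyticOnNhd_fun_prod (𝕜 := ℂ) (s := U) Finset.univ
    (f := fun (i : ι) z => F z (Finsupp.single i 1) (σ i)) fun i _ => hF i (σ i)
  rcases Int.units_eq_one_or (Equiv.Perm.sign σ) with hσ | hσ
  · simpa [hσ] using h
  · simp only [hσ, Units.neg_smul, one_smul]
    exact h.neg

end AnalyticFamilies

/-! ### The complex deformation `f + z x`. -/

section Deformation

variable {B W : Type*} [Group W] {M : CoxeterMatrix B} {cs : CoxeterSystem M W}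
  {K : Set W} {f x : Dual ℝ (RootSpace B)}

/-- The complex valued functional `f + z x`. -/
def deform (f x : Dual ℝ (RootSpace B)) (z : ℂ) : RootSpace B →ₗ[ℝ] ℂ :=
  Complex.ofRealCLM.toLinearMap ∘ₗ f + z • (Complex.ofRealCLM.toLinearMap ∘ₗ x)

theorem deform_apply (z : ℂ) (v : RootSpace B) : deform f x z v = f v + z * x v := by
  simp [deform]

theorem root_eq_posRoot_or_neg (hM : IsSimplyLaced M) (w : W) (i : B) :
    root cs w i = posRoot cs (w * cs.simple i * w⁻¹) ∨
      root cs w i = -posRoot cs (w * cs.simple i * w⁻¹) := by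
  rcases mem_posRootSet_or_neg hM (root_mem_rootSet (cs := cs) w i) with h | h
  · exact Or.inl (posRoot_conj_of_mem h).symm
  · exact Or.inr (by rw [posRoot_conj_of_neg_mem h, neg_neg])

theorem IsGeneric.isComplexGeneric_deform (hM : IsSimplyLaced M) (hf : IsGeneric cs K f)
    (hx : ∀ t ∈ boundaryRefl cs K, x (posRoot cs t) = 0) {z : ℂ}
    (hz : ∀ t ∈ innerRefl cs K, deform f x z (posRoot cs t) ≠ 0 ∧
      deform f x z (posRoot cs t) ≠ 1 ∧ deform f x z (posRoot cs t) ≠ -1) :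
    IsComplexGeneric cs K (deform f x z) where
  inner w hw i hi := by
    have h := hz _ ⟨w, hw, i, hi, rfl⟩
    rcases root_eq_posRoot_or_neg (cs := cs) hM w i with h' | h'
    · rwa [h']
    · rw [h', map_neg]
      exact ⟨neg_ne_zero.2 h.1, fun h1 => h.2.2 (neg_eq_iff_eq_neg.1 h1),
        fun h1 => h.2.1 (neg_injective h1)⟩
  boundary w hw i hi := by
    have hmem : w * cs.simple i * w⁻¹ ∈ boundaryRefl cs K := ⟨w, hw, i, hi, rfl⟩
    have h0 := hx _ hmem
    rcases root_eq_posRoot_or_neg (cs := cs) hM w i with h' | h' <;>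
      rcases hf.boundary _ hmem with h | h <;>
      simp [h', deform_apply, h, h0]
  corner w hw i j hij hi hj := by
    have hs : ∀ i, stepSign cs w i * f (posRoot cs (w * cs.simple i * w⁻¹)) = f (root cs w i) :=
      fun i => by rw [← stepSign_smul_posRoot hM, map_smul, smul_eq_mul]
    have h := hf.corner w hw i j hij hi hj
    rw [hs, hs] at h
    have h0 : ∀ i, w * cs.simple i ∉ K → x (root cs w i) = 0 := by
      intro i hi
      rw [← stepSign_smul_posRoot hM, map_smul, hx _ ⟨w, hw, i, hi, rfl⟩, smul_zero]
    rw [deform_apply, deform_apply, h, h0 i hi, h0 j hj]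

/-- The parameters for which `f + z x` is generic. -/
def genericParams (cs : CoxeterSystem M W) (K : Set W) (f x : Dual ℝ (RootSpace B)) : Set ℂ :=
  {z | IsComplexGeneric cs K (deform f x z)}

theorem finite_compl_genericParams (hM : IsSimplyLaced M) (hfin : K.Finite)
    (hf : IsGeneric cs K f) (hx : ∀ t ∈ boundaryRefl cs K, x (posRoot cs t) = 0) :
    (genericParams cs K f x)ᶜ.Finite := by
  -- Each forbidden value imposes an affine equation on `z` which fails at `z = 0` by genericity of
  -- `f`, so it has at most one solution.
  have hlin : ∀ a b c : ℝ, a ≠ c → {z : ℂ | (a : ℂ) + z * b = c}.Finite := by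
    intro a b c hac
    refine Set.Subsingleton.finite fun z hz z' hz' => ?_
    have hz1 : (a : ℂ) + z * b = c := hz
    have hz2 : (a : ℂ) + z' * b = c := hz'
    have hb : (b : ℂ) ≠ 0 := by
      intro hb
      rw [hb, mul_zero, add_zero] at hz1
      exact hac (by exact_mod_cast hz1)
    apply mul_right_cancel₀ hb
    linear_combination hz1 - hz2
  refine ((innerRefl_finite (cs := cs) hfin).biUnion (t := fun t =>
    {z : ℂ | (f (posRoot cs t) : ℂ) + z * x (posRoot cs t) = (0 : ℝ)} ∪
      {z : ℂ | (f (posRoot cs t) : ℂ) + z * x (posRoot cs t) = (1 : ℝ)} ∪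
      {z : ℂ | (f (posRoot cs t) : ℂ) + z * x (posRoot cs t) = (-1 : ℝ)}) fun t ht => ?_).subset ?_
  · obtain ⟨h0, h1, h2⟩ := hf.inner t ht
    exact ((hlin _ _ _ h0).union (hlin _ _ _ h1)).union (hlin _ _ _ h2)
  · intro z hz
    by_contra hz'
    refine hz (hf.isComplexGeneric_deform hM hx fun t ht => ?_)
    simp only [Set.mem_iUnion, Set.mem_union, Set.mem_ofPred_eq, not_exists, not_or] at hz'
    have h := hz' t ht
    rw [deform_apply]
    push_cast at h
    exact ⟨h.1.1, h.1.2, h.2⟩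

theorem isAnalyticFamily_youngOp (i : B) : IsAnalyticFamily (genericParams cs K f x)
    fun z => youngOp cs K (deform f x z) i := by
  rintro ⟨u, hu⟩ v
  have hinv : AnalyticOnNhd ℂ (fun z => (deform f x z (root cs u i))⁻¹)
      (genericParams cs K f x) := by
    simp only [deform_apply]
    refine AnalyticOnNhd.inv ?_ fun z hz => ?_
    · exact analyticOnNhd_const.add (analyticOnNhd_id.mul analyticOnNhd_const)
    · rw [← deform_apply]
      exact IsComplexGeneric.ne_zero hz hu i
  have hstep : AnalyticOnNhd ℂ (fun z => stepWeight cs K (deform f x z) u i)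
      (genericParams cs K f x) := by
    unfold stepWeight rootWeight
    split_ifs
    · exact analyticOnNhd_const
    · exact analyticOnNhd_const.sub (hinv.pow 2)
    · exact analyticOnNhd_const
  simp only [← basisVec_of_mem hu, youngOp_basisVec, Finsupp.add_apply, Finsupp.smul_apply,
    smul_eq_mul]
  exact (hinv.mul analyticOnNhd_const).add (hstep.mul analyticOnNhd_const)

theorem youngOp_congr {g g' : RootSpace B →ₗ[ℝ] ℂ} {i : B}
    (h : ∀ w, g (root cs w i) = g' (root cs w i)) : youngOp cs K g i = youngOp cs K g' i := by
  simp only [youngOp, stepWeight, rootWeight, h]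

/-- The product of the operators of the generators along a chosen word for `w`. -/
def youngProd (cs : CoxeterSystem M W) (K : Set W) (g : RootSpace B →ₗ[ℝ] ℂ) (w : W) :
    Module.End ℂ (K →₀ ℂ) :=
  ((cs.wordProd_surjective w).choose.map (youngOp cs K g)).prod

/-- The product along a fixed word is defined without genericity, hence as a function of all `z ∈
ℂ`; this allows analyticity to be stated. -/
theorem youngProd_eq (hM : IsSimplyLaced M) (hconv : IsConvex cs K) {g : RootSpace B →ₗ[ℝ] ℂ}
    (hg : IsComplexGeneric cs K g) : youngProd cs K g = youngRep hM hconv hg := by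
  funext w
  conv_rhs => rw [← (cs.wordProd_surjective w).choose_spec]
  rw [youngProd]
  generalize (cs.wordProd_surjective w).choose = l
  rw [CoxeterSystem.wordProd, map_list_prod, List.map_map]
  congr 2
  funext i
  exact (youngRep_simple hM hconv hg i).symm

variable (hM : IsSimplyLaced M) (hconv : IsConvex cs K)

theorem mul_averageOver_youngRep {a z : ℂ} (ha : IsComplexGeneric cs K (deform f x a))
    (hz : IsComplexGeneric cs K (deform f x z)) [Fintype (linkedSubgroup cs x)] (w : W) :
    youngRep hM hconv hz w *
        averageOver (linkedSubgroup cs x) (youngRep hM hconv ha) (youngRep hM hconv hz) =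
      averageOver (linkedSubgroup cs x) (youngRep hM hconv ha) (youngRep hM hconv hz) *
        youngRep hM hconv ha w := by
  have : (linkedSubgroup cs x).Normal := linkedSubgroup_normal
  induction w using cs.simple_induction_left with
  | one => rw [map_one, map_one, one_mul, mul_one]
  | mul_simple_left w i ih =>
    rw [map_mul, map_mul, mul_assoc, ih, ← mul_assoc, ← mul_assoc]
    congr 1
    rcases simple_mem_linkedSubgroup_or (cs := cs) (x := x) i with h | h
    · exact mul_averageOver_of_mem _ _ _ h
    · apply mul_averageOver_of_eq
      rw [youngRep_simple, youngRep_simple]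
      refine youngOp_congr fun w => ?_
      rw [deform_apply, deform_apply, h w]
      simp

theorem nonempty_equiv_of_det_ne_zero (hfin : K.Finite) {a z : ℂ}
    (ha : IsComplexGeneric cs K (deform f x a)) (hz : IsComplexGeneric cs K (deform f x z))
    [Fintype (linkedSubgroup cs x)]
    (h : LinearMap.det (averageOver (linkedSubgroup cs x) (youngProd cs K (deform f x a))
      (youngProd cs K (deform f x z))) ≠ 0) :
    Nonempty ((youngRep hM hconv ha).Equiv (youngRep hM hconv hz)) := by
  have := hfin.to_subtype
  rw [youngProd_eq hM hconv ha, youngProd_eq hM hconv hz] at h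
  exact ⟨.mk (LinearMap.equivOfDetNeZero _ h) fun w =>
    (mul_averageOver_youngRep hM hconv ha hz w).symm⟩

/-- Two members of a family of Young representations `f + z x` in which only finitely many roots
have varying values are isomorphic. -/
theorem nonempty_equiv_youngRep_deform (hfin : K.Finite) (hf : IsGeneric cs K f)
    (hx : ∀ t ∈ boundaryRefl cs K, x (posRoot cs t) = 0)
    (hx' : {β | β ∈ rootSet cs ∧ x β ≠ 0}.Finite) {a b : ℂ}
    (ha : IsComplexGeneric cs K (deform f x a))
    (hb : IsComplexGeneric cs K (deform f x b)) :
    Nonempty ((youngRep hM hconv ha).Equiv (youngRep hM hconv hb)) := by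
  have := linkedSubgroup_finite hM hx'
  have := Fintype.ofFinite (linkedSubgroup cs x)
  have := hfin.fintype
  set U := genericParams cs K f x with hU
  let D : ℂ → ℂ → ℂ := fun a z => LinearMap.det (averageOver (linkedSubgroup cs x)
    (youngProd cs K (deform f x a)) (youngProd cs K (deform f x z)))
  have hD : ∀ a, AnalyticOnNhd ℂ (D a) U := fun a => IsAnalyticFamily.det <|
    IsAnalyticFamily.sum _ fun n => IsAnalyticFamily.mul
      (IsAnalyticFamily.list_prod isAnalyticFamily_youngOp _) (isAnalyticFamily_const _)
  have hD' : ∀ a ∈ U, D a a ≠ 0 := by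
    intro a ha
    simp only [D]
    -- At equal parameters the average is the order of the subgroup times the identity.
    rw [youngProd_eq hM hconv ha, averageOver_self, LinearMap.det_smul, map_one, mul_one]
    exact pow_ne_zero _ (Nat.cast_ne_zero.2 Fintype.card_ne_zero)
  have hconn : IsPreconnected U := by
    have h := (finite_compl_genericParams hM hfin hf hx).countable.isConnected_compl_of_one_lt_rank
      (by simp)
    rw [compl_compl] at h
    exact h.isPreconnected
  -- `D a b` itself may vanish; but a product of two analytic functions, neither identically zero on
  -- the connected set `U`, is nonzero at some third parameter.
  obtain ⟨z, hz, hz1, hz2⟩ : ∃ z ∈ U, D a z ≠ 0 ∧ D b z ≠ 0 := by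
    by_contra! h
    rcases (hD a).eq_zero_or_eq_zero_of_mul_eq_zero (hD b) (fun z hz => by
      by_cases h0 : D a z = 0
      · rw [h0, zero_mul]
      · rw [h z hz h0, mul_zero]) hconn with h0 | h0
    · exact hD' a ha (h0 a ha)
    · exact hD' b hb (h0 b hb)
  obtain ⟨e⟩ := nonempty_equiv_of_det_ne_zero hM hconv hfin ha hz hz1
  obtain ⟨e'⟩ := nonempty_equiv_of_det_ne_zero hM hconv hfin hb hz hz2
  exact ⟨e.trans e'.symm⟩

end Deformation

/-! ### Passage to the symmetric normalization. -/

section Normalization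

variable {B W : Type*} [Group W] {M : CoxeterMatrix B} {cs : CoxeterSystem M W}
  {K : Set W} {f : Dual ℝ (RootSpace B)} {g : RootSpace B →ₗ[ℝ] ℂ} {b : W → ℂ}

open Classical in
/-- The product of the numbers `b t` over the `t ∈ T_K` inverted by `w`. -/
def inversionProd (cs : CoxeterSystem M W) (hfin : K.Finite) (b : W → ℂ) (w : W) : ℂ :=
  ∏ t ∈ (innerRefl_finite (cs := cs) hfin).toFinset with
    geomRep cs w⁻¹ (posRoot cs t) ∉ posRootSet cs, b t

theorem inversionProd_mul_simple (hM : IsSimplyLaced M) (hfin : K.Finite) {w : W} {i : B}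
    (hw : w ∈ K) (hi : w * cs.simple i ∈ K) (hpos : root cs w i ∈ posRootSet cs) :
    inversionProd cs hfin b (w * cs.simple i) =
      b (w * cs.simple i * w⁻¹) * inversionProd cs hfin b w := by
  classical
  have hroot := posRoot_conj_of_mem hpos
  have h1 : geomRep cs w⁻¹ (root cs w i) = simpleRoot i := geomRep_inv_apply_self cs w _
  have h2 : geomRep cs (w * cs.simple i)⁻¹ (root cs w i) = -simpleRoot i := by
    rw [← neg_neg (root cs w i), ← root_mul_simple_self, map_neg]
    exact congrArg _ (geomRep_inv_apply_self cs _ _)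
  have h3 := simpleRoot_mem_posRootSet (cs := cs) i
  unfold inversionProd
  rw [← Finset.prod_insert]
  · refine Finset.prod_congr ?_ fun _ _ => rfl
    ext t
    simp only [Finset.mem_insert, Finset.mem_filter, Set.Finite.mem_toFinset]
    by_cases ht : t = w * cs.simple i * w⁻¹
    · subst ht
      rw [hroot, h2]
      exact iff_of_true ⟨⟨w, hw, i, hi, rfl⟩, neg_notMem_posRootSet h3⟩ (Or.inl rfl)
    · simp only [ht, false_or]
      refine and_congr_right fun htK => not_congr ?_
      by_contra h
      exact ht (eq_conj_of_separates hM (isReflection_of_mem_innerRefl htK) fun h' => h h'.symm)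
  · rw [Finset.mem_filter, hroot, h1]
    exact fun h => h.2 h3

theorem inversionProd_ne_zero (hfin : K.Finite) (hb : ∀ t ∈ innerRefl cs K, b t ≠ 0) (w : W) :
    inversionProd cs hfin b w ≠ 0 := by
  classical
  refine Finset.prod_ne_zero_iff.2 fun t ht => hb t ?_
  simpa using (Finset.mem_filter.1 ht).1

/-- An upward step multiplies the inversion product by `b t` and has weight `1`; a downward step
divides it by `b t` and has weight `(b t)²`. Rescaling `C_w` by this product thus makes both weights
`b t`. -/
theorem rootWeight_mul_inversionProd (hM : IsSimplyLaced M) (hfin : K.Finite)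
    (hb : ∀ w ∈ K, ∀ i, w * cs.simple i ∈ K →
      b (w * cs.simple i * w⁻¹) * b (w * cs.simple i * w⁻¹) = 1 - (g (root cs w i))⁻¹ ^ 2)
    {w : W} {i : B} (hw : w ∈ K) (hi : w * cs.simple i ∈ K) :
    rootWeight cs g (root cs w i) * inversionProd cs hfin b (w * cs.simple i) =
      b (w * cs.simple i * w⁻¹) * inversionProd cs hfin b w := by
  rw [rootWeight]
  split_ifs with h
  · rw [one_mul, inversionProd_mul_simple hM hfin hw hi h]
  · have h' := (neg_mem_posRootSet_iff hM (root_mem_rootSet w i)).2 h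
    rw [← root_mul_simple_self] at h'
    have h1 := inversionProd_mul_simple (b := b) hM hfin hi (by simpa using hw) h'
    have h2 : w * cs.simple i * cs.simple i * (w * cs.simple i)⁻¹ = w * cs.simple i * w⁻¹ := by
      simp [mul_assoc]
    rw [cs.simple_mul_simple_cancel_right] at h1 h2
    rw [h2] at h1
    rw [h1, ← hb w hw i hi, mul_assoc]

/-- Diagonal rescaling of the basis vectors by nonzero numbers. -/
def rescale {W : Type*} (K : Set W) (d : W → ℂ) (hd : ∀ w, d w ≠ 0) : (K →₀ ℂ) ≃ₗ[ℂ] (K →₀ ℂ) :=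
  LinearEquiv.ofLinearMap
    (Finsupp.linearCombination ℂ fun w : K => d w • Finsupp.single w (1 : ℂ))
    (Finsupp.linearCombination ℂ fun w : K => (d w)⁻¹ • Finsupp.single w (1 : ℂ))
    (by ext u v; simp [hd]) (by ext u v; simp [hd])

theorem rescale_basisVec {W : Type*} {K : Set W} {d : W → ℂ} (hd : ∀ w, d w ≠ 0) (w : W) :
    rescale K d hd (basisVec K w) = d w • basisVec K w := by
  by_cases hw : w ∈ K
  · simp [basisVec_of_mem hw, rescale]
  · simp [basisVec_of_notMem hw]

theorem rescale_symm_basisVec {W : Type*} {K : Set W} {d : W → ℂ} (hd : ∀ w, d w ≠ 0) (w : W) :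
    (rescale K d hd).symm (basisVec K w) = (d w)⁻¹ • basisVec K w := by
  rw [LinearEquiv.symm_apply_eq, map_smul, rescale_basisVec, inv_smul_smul₀ (hd w)]

theorem exists_isAYRep (hM : IsSimplyLaced M) (hconv : IsConvex cs K) (hfin : K.Finite)
    (hf : IsGeneric cs K f) (hg : IsComplexGeneric cs K g) (hgf : ∀ v, g v = f v)
    (hb : IsSymmNormalization cs f K b) :
    ∃ ρ : Representation ℂ W (K →₀ ℂ), IsAYRep cs f K b ρ ∧
      Nonempty (ρ.Equiv (youngRep hM hconv hg)) := by
  have hcoef : ∀ w i, (if cs.length w < cs.length (w * cs.simple i) then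
      aDot cs f (w * cs.simple i * w⁻¹) else -aDot cs f (w * cs.simple i * w⁻¹)) =
      (g (root cs w i))⁻¹ := by
    intro w i
    have h := stepSign_smul_posRoot (cs := cs) hM w i
    rw [← h, hgf, map_smul, stepSign]
    split_ifs <;> simp [aDot, inv_neg]
  -- `b t = 0` would force `f` to take the value `1` or `-1` on an inner root.
  have hb0 : ∀ t ∈ innerRefl cs K, b t ≠ 0 := by
    intro t ht h0
    have h := hb t ht
    obtain ⟨h1, h2, h3⟩ := hf.inner t ht
    have h4 : (f (posRoot cs t) : ℂ) ≠ 0 := by exact_mod_cast h1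
    rw [h0, mul_zero, aDot, Complex.ofReal_div, Complex.ofReal_one] at h
    field_simp at h
    have h5 : (f (posRoot cs t) - 1) * (f (posRoot cs t) + 1) = 0 := by
      have : ((f (posRoot cs t) : ℂ) - 1) * ((f (posRoot cs t) : ℂ) + 1) = 0 := by
        linear_combination -h
      exact_mod_cast this
    rcases mul_eq_zero.1 h5 with h6 | h6
    · exact h2 (by linarith)
    · exact h3 (by linarith)
  have hbsq : ∀ w ∈ K, ∀ i, w * cs.simple i ∈ K →
      b (w * cs.simple i * w⁻¹) * b (w * cs.simple i * w⁻¹) = 1 - (g (root cs w i))⁻¹ ^ 2 := by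
    intro w hw i hi
    rw [hb _ ⟨w, hw, i, hi, rfl⟩, ← hcoef]
    split_ifs <;> ring
  have hd := inversionProd_ne_zero hfin hb0
  let D := rescale K _ hd
  let ρ : Representation ℂ W (K →₀ ℂ) :=
    (D.conjRingEquiv : Module.End ℂ (K →₀ ℂ) →* Module.End ℂ (K →₀ ℂ)).comp
      (youngRep hM hconv hg)
  have hρ : ∀ w v, ρ w v = D (youngRep hM hconv hg w (D.symm v)) := fun w v => rfl
  refine ⟨ρ, fun w hw i => ?_, ⟨.mk D.symm fun w => ?_⟩⟩
  · rw [hρ, youngRep_simple, rescale_symm_basisVec, map_smul, youngOp_basisVec, map_smul, map_add,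
      map_smul, map_smul, rescale_basisVec, rescale_basisVec, hcoef, smul_add]
    congr 1
    · rw [smul_smul, smul_smul]
      congr 1
      field_simp [hd w]
    · by_cases hi : w * cs.simple i ∈ K
      · rw [smul_smul, smul_smul, stepWeight_of_mem hw hi, mul_assoc,
          rootWeight_mul_inversionProd hM hfin hbsq hw hi]
        congr 1
        field_simp [hd w]
      · simp [basisVec_of_notMem hi]
  · refine LinearMap.ext fun v => ?_
    change D.symm (ρ w v) = youngRep hM hconv hg w (D.symm v)
    rw [hρ, D.symm_apply_apply]

end Normalization

end AbstractYoung

end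

/-! ### The isomorphism theorem, from the parameters `0` and `1` of the deformation. -/

theorem theorem3p3 {B W : Type*} [Group W] {M : CoxeterMatrix B} (cs : CoxeterSystem M W)
    (hM : AbstractYoung.IsSimplyLaced M)
    (L : Set (Module.Dual ℝ (AbstractYoung.RootSpace B))) (hL : AbstractYoung.IsBasicFlat cs L)
    (K : Set W) (hK : K ∈ AbstractYoung.flatPartition cs L) (hfin : K.Finite)
    (hconv : AbstractYoung.IsConvex cs K)
    (v v' : W) (hv : v ∈ K) (hv' : v' ∈ K)
    (f f' : Module.Dual ℝ (AbstractYoung.RootSpace B)) (hf : f ∈ L) (hf' : f' ∈ L)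
    (hgen : AbstractYoung.IsGeneric cs K f) (hgen' : AbstractYoung.IsGeneric cs K f') :
    AbstractYoung.cell cs f v = K ∧ AbstractYoung.cell cs f' v' = K ∧
    ∀ b b' : W → ℂ,
      AbstractYoung.IsSymmNormalization cs f (AbstractYoung.cell cs f v) b →
      AbstractYoung.IsSymmNormalization cs f' (AbstractYoung.cell cs f' v') b' →
      ∃ (ρ : Representation ℂ W (AbstractYoung.cell cs f v →₀ ℂ))
        (ρ' : Representation ℂ W (AbstractYoung.cell cs f' v' →₀ ℂ)),
        AbstractYoung.IsAYRep cs f (AbstractYoung.cell cs f v) b ρ ∧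
        AbstractYoung.IsAYRep cs f' (AbstractYoung.cell cs f' v') b' ρ' ∧
        Nonempty (ρ.Equiv ρ') := by
  have h1 := hgen.cell_eq hM hK hconv hf hv
  have h2 := hgen'.cell_eq hM hK hconv hf' hv'
  refine ⟨h1, h2, ?_⟩
  rw [h1, h2]
  intro b b' hb hb'
  have hx : ∀ t ∈ AbstractYoung.boundaryRefl cs K, (f' - f) (AbstractYoung.posRoot cs t) = 0 := by
    intro t ht
    rw [LinearMap.sub_apply, AbstractYoung.eq_on_boundaryRefl hM hK hf' hf ht, sub_self]
  have hx' := AbstractYoung.finite_setOf_apply_ne_zero hM hfin ⟨v, hv⟩ hconv hx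
  have e0 : ∀ u, AbstractYoung.deform f (f' - f) 0 u = f u := fun u => by
    simp [AbstractYoung.deform_apply]
  have e1 : ∀ u, AbstractYoung.deform f (f' - f) 1 u = f' u := fun u => by
    simp [AbstractYoung.deform_apply]
  have m0 : 0 ∈ AbstractYoung.genericParams cs K f (f' - f) :=
    hgen.isComplexGeneric_deform hM hx fun t ht => by
      rw [e0]; exact_mod_cast hgen.inner t ht
  have m1 : 1 ∈ AbstractYoung.genericParams cs K f (f' - f) :=
    hgen.isComplexGeneric_deform hM hx fun t ht => by
      rw [e1]; exact_mod_cast hgen'.inner t ht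
  obtain ⟨ρ, hρ, ⟨e⟩⟩ := AbstractYoung.exists_isAYRep hM hconv hfin hgen m0 e0 hb
  obtain ⟨ρ', hρ', ⟨e'⟩⟩ := AbstractYoung.exists_isAYRep hM hconv hfin hgen' m1 e1 hb'
  obtain ⟨d⟩ := AbstractYoung.nonempty_equiv_youngRep_deform hM hconv hfin hgen hx hx' m0 m1
  exact ⟨ρ, ρ', hρ, hρ', ⟨(e.trans d).trans e'.symm⟩⟩
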